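/- Let $\widehat{\mathbb C}=\mathbb C\cup\{\infty\}$ be the Riemann sphere. Let $E=\bigcup_{j=1}^n E_j$ with $n\ge 1$, where $E_1,\dots,E_n\subseteq\mathbb C$ are pairwise disjoint compact sets, none a single point, each simply connected (that is, connected with connected complement), and let $\mathcal K=\widehat{\mathbb C}\setminus E$. Let $\mathcal L$ be a lemniscatic domain $$\mathcal L=\Big\{w\in\widehat{\mathbb C}:\ \prod_{j=1}^n|w-a_j|^{m_j}>\mu\Big\},$$ with $a_1,\dots,a_n\in\mathbb C$ pairwise distinct, $m_1,\dots,m_n>0$, $\sum_{j=1}^n m_j=1$ and $\mu>0$ (the point $\infty$ belongs to $\mathcal L$), and let $\Phi:\mathcal K\to\mathcal L$ be the lemniscatic map of $\mathcal K$, that is, a bijective conformal map with $\Phi(\infty)=\infty$ and $\Phi(z)=z+\mathcal O(1/z)$ for $z$ near infinity. Here $n$ is the same for $E$ and for $\mathcal L$. Let $\Phi^{-1}:\mathcal L\to\mathcal K$ be the inverse of $\Phi$. For $S\subseteq\widehat{\mathbb C}$ write $e^{i\theta}S=\{e^{i\theta}z:z\in S\}$, $S^*=\{\overline z:z\in S\}$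 and $-S=\{-z:z\in S\}$, where $e^{i\theta}\infty=\overline\infty=-\infty=\infty$. Then: 1. For every $\theta\in\mathbb R$, if $\mathcal K=e^{i\theta}\mathcal K$, then $\Phi(z)=e^{-i\theta}\Phi(e^{i\theta}z)$ for all $z\in\mathcal K$, $\mathcal L=e^{i\theta}\mathcal L$, and $\Phi^{-1}(w)=e^{-i\theta}\Phi^{-1}(e^{i\theta}w)$ for all $w\in\mathcal L$. 2. If $\mathcal K=\mathcal K^*$, then $\Phi(z)=\overline{\Phi(\overline z)}$ for all $z\in\mathcal K$, $\mathcal L=\mathcal L^*$, and $\Phi^{-1}(w)=\overline{\Phi^{-1}(\overline w)}$ for all $w\in\mathcal L$. 3. If $\mathcal K=-\mathcal K^*$, then $\Phi(z)=-\overline{\Phi(-\overline z)}$ for all $z\in\mathcal K$, $\mathcal L=-\mathcal L^*$, and $\Phi^{-1}(w)=-\overline{\Phi^{-1}(-\overline w)}$ for all $w\in\mathcal L$. -/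

import Mathlib

noncomputable section

namespace Walsh

/-- The Riemann sphere, that is, the extended complex plane with its usual topology. -/
abbrev Sphere : Type := OnePoint ℂ

/-- The affine coordinate of a finite point (with the dummy value `0` at `∞`). -/
def toComplex (p : Sphere) : ℂ := p.elim 0 (fun z => z)

open Classical in
/-- The standard local coordinate of the sphere at `p`: `z` at a finite point, and `1/z`
(with value `0` at `∞`) at the point `∞`. -/
def localCoord (p : Sphere) : Sphere → ℂ :=
  if p = OnePoint.infty then fun q => q.elim 0 (fun z => z⁻¹) else toComplex

open Classical in
/-- The inverse of `localCoord p`: `ζ ↦ ζ` at a finite point, and `ζ ↦ 1/ζ`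
(with `0 ↦ ∞`) at the point `∞`. -/
def localParam (p : Sphere) : ℂ → Sphere :=
  if p = OnePoint.infty then
    fun ζ => if ζ = 0 then OnePoint.infty else ((ζ⁻¹ : ℂ) : Sphere)
  else fun ζ => (ζ : Sphere)

/-- Complex differentiability at `p` of a map of the sphere to itself: continuity at `p`, and
complex differentiability when written in the local coordinates at `p` and at `f p`. -/
def ComplexDiffAt (f : Sphere → Sphere) (p : Sphere) : Prop :=
  ContinuousAt f p ∧
    DifferentiableAt ℂ (fun ζ => localCoord (f p) (f (localParam p ζ))) (localCoord p p)

/-- `f` restricts to a bijective conformal (i.e. biholomorphic) map from the open subset `K` of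
the sphere onto the subset `L`. -/
def IsConformalBijection (f : Sphere → Sphere) (K L : Set Sphere) : Prop :=
  Set.BijOn f K L ∧ ∀ p ∈ K, ComplexDiffAt f p

/-- A compact plane set is simply connected if it is connected and does not separate the plane. -/
def IsSimplyConnectedCompact (S : Set ℂ) : Prop :=
  IsCompact S ∧ IsConnected S ∧ IsConnected Sᶜ

/-- The complement, in the sphere, of the union of the plane sets `E j`. -/
def exteriorDomain {n : ℕ} (E : Fin n → Set ℂ) : Set Sphere :=
  ((fun z : ℂ => (z : Sphere)) '' ⋃ j, E j)ᶜ

/-- `L = {w : |U w| > μ}`, with `|U w| = ∏ j, |w - a j| ^ m j` for finite `w` and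
`|U ∞| = ∞`. -/
def lemniscaticSet {n : ℕ} (a : Fin n → ℂ) (m : Fin n → ℝ) (μ : ℝ) : Set Sphere :=
  insert OnePoint.infty
    ((fun w : ℂ => (w : Sphere)) '' {w : ℂ | μ < ∏ j, ‖w - a j‖ ^ m j})

/-- Lemniscatic domains with `n` foci: the foci are pairwise distinct, the exponents are positive
with sum `1`, and `μ > 0`. -/
def IsLemniscaticDomain (n : ℕ) (L : Set Sphere) : Prop :=
  ∃ (a : Fin n → ℂ) (m : Fin n → ℝ) (μ : ℝ),
    Function.Injective a ∧ (∀ j, 0 < m j) ∧ ∑ j, m j = 1 ∧ 0 < μ ∧ L = lemniscaticSet a m μ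

/-- The normalization `f z = z + O(1/z)` for `z` near infinity (so `f` is finite at finite points
near infinity, and `f ∞ = ∞`). -/
def IsNormalizedAtInfinity (f : Sphere → Sphere) : Prop :=
  f OnePoint.infty = OnePoint.infty ∧
    (fun z : ℂ => toComplex (f z) - z) =O[Bornology.cobounded ℂ] (fun z : ℂ => z⁻¹)

/-- `Φ` is a lemniscatic map of `K = exteriorDomain E`, with lemniscatic domain `L`. The number
of foci of `L` is the number `n` of the sets `E j`. -/
structure IsLemniscaticMap {n : ℕ} (E : Fin n → Set ℂ) (L : Set Sphere)
    (Φ : Sphere → Sphere) : Prop where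
  isLemniscaticDomain : IsLemniscaticDomain n L
  conformal : IsConformalBijection Φ (exteriorDomain E) L
  normalized : IsNormalizedAtInfinity Φ

/-- The rotation `z ↦ e^{iθ} z` of the sphere, fixing `∞`. -/
def rot (θ : ℝ) : Sphere → Sphere :=
  OnePoint.map (fun z : ℂ => Complex.exp (θ * Complex.I) * z)

/-- Complex conjugation on the sphere, fixing `∞`. -/
def conj : Sphere → Sphere := OnePoint.map (fun z : ℂ => (starRingEnd ℂ) z)

/-- The map `z ↦ -z` of the sphere, fixing `∞`. -/
def neg : Sphere → Sphere := OnePoint.map (fun z : ℂ => -z)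

end Walsh

end

section

open Set Filter Topology Metric Bornology InnerProductSpace

namespace Walsh

/-! Everything follows from uniqueness of the lemniscatic map. If `σ` is one of the three
isometries, with inverse `τ`, and it preserves `K`, then `τ ∘ Φ ∘ σ` is again a normalized conformal
map of `K`, onto the lemniscatic domain with foci `τ (a j)` and the same exponents and level.
Uniqueness gives `Φ = τ ∘ Φ ∘ σ`, and the claims on `L` and on the inverse are formal consequences
(`IsLemniscaticMap.symmetry`).

For uniqueness (`eqOn_of_normalizedConformal`), let `T` be the transition map between two
lemniscatic domains of the same level `μ`. The maximum principle, applied to a difference of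
logarithms that vanishes at infinity, shows that `T` carries one modulus function to the other
(`lemMod_map_eq`). It remains to extend `T` to an entire function `F` with `F z - z → 0`, which is
the identity by Liouville.

The extension rests on two facts. As there are as many foci as sets `E j`, each component of a
sublevel set slightly above `μ` contains a single focus (`exists_level_isolating_foci`, which uses
unicoherence of the plane). On such a component a branch of `∏ (w - a j) ^ (m j / m i)` is a Riemann
map onto a disc whose modulus is a power of `lemMod` (`exists_inner_map`). In these coordinates `T`
is an injective map of an annulus with `‖S ζ‖ = ‖ζ‖ ^ α`, hence a rotation
(`eq_const_mul_of_norm_eq_rpow`), and rotations extend to the disc. -/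

/-! ### Injective holomorphic functions -/

/-- Near a critical point, a nonconstant holomorphic function takes all nearby values other than the
critical one at least twice. -/
theorem eventually_exists_two_preimages {f : ℂ → ℂ} {z₀ : ℂ} {s : Set ℂ} (hf : AnalyticAt ℂ f z₀)
    (hne : ¬ ∀ᶠ z in 𝓝 z₀, f z = f z₀) (hd : deriv f z₀ = 0) (hs : s ∈ 𝓝 z₀) :
    ∀ᶠ ζ in 𝓝 (f z₀), ζ ≠ f z₀ → ∃ x ∈ s, ∃ y ∈ s, x ≠ y ∧ f x = ζ ∧ f y = ζ := by
  have hf' : AnalyticAt ℂ (fun z => f z - f z₀) z₀ := hf.sub analyticAt_const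
  simp_rw [← sub_eq_zero (b := f z₀)] at hne
  obtain ⟨n, g, hg, hg0, hfg⟩ := hf'.exists_eventuallyEq_pow_smul_nonzero_iff.2 hne
  have hn0 : n ≠ 0 := by
    rintro rfl
    have := hfg.self_of_nhds
    simp at this
    exact hg0 this.symm
  obtain ⟨c, hc⟩ := IsAlgClosed.exists_pow_nat_eq (g z₀) (Nat.pos_of_ne_zero hn0)
  have hn' : (n : ℂ) ≠ 0 := Nat.cast_ne_zero.2 hn0
  have hc0 : c ≠ 0 := by
    rintro rfl
    rw [zero_pow hn0] at hc
    exact hg0 hc.symm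
  -- A holomorphic `n`-th root of `f - f z₀`: since `g z / g z₀` is near `1`, the principal
  -- logarithm applies. It is a local coordinate at `z₀`, and `f - f z₀` is its `n`-th power.
  set v : ℂ → ℂ := fun z => (z - z₀) * (c * Complex.exp (Complex.log (g z / g z₀) / n)) with hv
  have hslit : g z₀ / g z₀ ∈ Complex.slitPlane := by rw [div_self hg0]; exact Complex.one_mem_slitPlane
  have hva : AnalyticAt ℂ v z₀ :=
    (analyticAt_id.sub analyticAt_const).mul (analyticAt_const.mul
      (((hg.div analyticAt_const hg0).clog hslit).div analyticAt_const hn').cexp)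
  have hv0 : v z₀ = 0 := by simp [hv]
  have hvd : deriv v z₀ = c := by
    have h1 : HasDerivAt (fun z => z - z₀) 1 z₀ := (hasDerivAt_id z₀).sub_const z₀
    have h2 : AnalyticAt ℂ (fun z => c * Complex.exp (Complex.log (g z / g z₀) / n)) z₀ :=
      (analyticAt_const.mul
        (((hg.div analyticAt_const hg0).clog hslit).div analyticAt_const hn').cexp)
    have h3 := (h1.mul h2.differentiableAt.hasDerivAt).deriv
    simp only [hg0, div_self, ne_eq, not_false_eq_true] at h3
    simp only [sub_self, zero_mul, add_zero, one_mul, Complex.log_one, zero_div, Complex.exp_zero,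
      mul_one] at h3
    exact h3
  have hvpow : ∀ᶠ z in 𝓝 z₀, f z - f z₀ = v z ^ n := by
    filter_upwards [hfg, hg.continuousAt.eventually_ne hg0] with z hz hgz
    rw [hz, hv]
    simp only [mul_pow, smul_eq_mul]
    rw [← Complex.exp_nat_mul, mul_div_cancel₀ _ hn', Complex.exp_log (div_ne_zero hgz hg0), hc,
      mul_div_cancel₀ _ hg0]
  have hmap : map v (𝓝 z₀) = 𝓝 0 := by
    rw [← hv0]
    refine hva.hasStrictDerivAt.map_nhds_eq ?_
    rwa [hvd]
  have himg : v '' (s ∩ {z | f z - f z₀ = v z ^ n}) ∈ 𝓝 (0 : ℂ) := by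
    rw [← hmap]
    exact image_mem_map (inter_mem hs hvpow)
  obtain ⟨r, hr, hball⟩ := Metric.mem_nhds_iff.1 himg
  have hn1 : n ≠ 1 := by
    rintro rfl
    have h1 : HasDerivAt (fun z => z - z₀) 1 z₀ := (hasDerivAt_id z₀).sub_const z₀
    have h3 := (h1.mul hg.differentiableAt.hasDerivAt).congr_of_eventuallyEq
      (f₁ := fun z => f z - f z₀) (by filter_upwards [hfg] with z hz; simpa using hz)
    have h4 := h3.add_const (f z₀)
    have h5 : deriv f z₀ = g z₀ := by simpa using h4.deriv
    exact hg0 (h5.symm.trans hd)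
  -- The two preimages of `ζ` are the points where `v` equals `e` and `ω * e`, two distinct `n`-th
  -- roots of `ζ - f z₀`.
  have hω := Complex.isPrimitiveRoot_exp n hn0
  set ω := Complex.exp (2 * Real.pi * Complex.I / n)
  have hωn : ‖ω‖ = 1 := hω.norm'_eq_one hn0
  have hω1 : ω ≠ 1 := fun h => hn1 (Nat.dvd_one.1
    ((hω.pow_eq_one_iff_dvd 1).1 (by rw [h, one_pow])))
  filter_upwards [ball_mem_nhds (f z₀) (pow_pos hr n)] with ζ hζ hζ0
  obtain ⟨e, he⟩ := IsAlgClosed.exists_pow_nat_eq (ζ - f z₀) (Nat.pos_of_ne_zero hn0)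
  have he0 : e ≠ 0 := by
    rintro rfl
    rw [zero_pow hn0] at he
    exact hζ0 (sub_eq_zero.1 he.symm)
  have her : ‖e‖ < r := by
    rw [mem_ball_iff_norm, ← he, norm_pow] at hζ
    exact lt_of_pow_lt_pow_left₀ n hr.le hζ
  obtain ⟨x, ⟨hxs, hx⟩, hxe⟩ := hball (mem_ball_zero_iff.2 her)
  obtain ⟨y, ⟨hys, hy⟩, hye⟩ := hball (show ω * e ∈ ball (0 : ℂ) r by
    rwa [mem_ball_zero_iff, norm_mul, hωn, one_mul])
  simp only [mem_ofPred_eq] at hx hy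
  refine ⟨x, hxs, y, hys, fun hxy => ?_, ?_, ?_⟩
  · rw [← hxy, hxe] at hye
    exact hω1 (mul_right_cancel₀ he0 (by rw [← hye, one_mul]))
  · rw [hxe, he] at hx
    exact sub_left_injective hx
  · rw [hye, mul_pow, hω.pow_eq_one, one_mul, he] at hy
    exact sub_left_injective hy

theorem not_eventually_eq_of_injOn {f : ℂ → ℂ} {z₀ : ℂ} {s : Set ℂ} (hs : s ∈ 𝓝 z₀)
    (hinj : InjOn f s) : ¬ ∀ᶠ z in 𝓝 z₀, f z = f z₀ := by
  intro h
  have h2 : ∃ᶠ z in 𝓝[≠] z₀, z ∈ ({z₀}ᶜ : Set ℂ) := eventually_mem_nhdsWithin.frequently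
  refine h2 ?_
  filter_upwards [(h.and hs).filter_mono nhdsWithin_le_nhds] with z hz hne
  exact hne (hinj hz.2 (mem_of_mem_nhds hs) hz.1)

theorem nhds_le_map_nhds_of_not_eventually_eq {f : ℂ → ℂ} {z₀ : ℂ} (hf : AnalyticAt ℂ f z₀)
    (hne : ¬ ∀ᶠ z in 𝓝 z₀, f z = f z₀) : 𝓝 (f z₀) ≤ map f (𝓝 z₀) :=
  hf.eventually_constant_or_nhds_le_map_nhds.resolve_left hne

theorem deriv_ne_zero_of_injOn {f : ℂ → ℂ} {z₀ : ℂ} {s : Set ℂ} (hf : AnalyticAt ℂ f z₀)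
    (hs : s ∈ 𝓝 z₀) (hinj : InjOn f s) : deriv f z₀ ≠ 0 := by
  intro hd
  have h1 := eventually_exists_two_preimages hf (not_eventually_eq_of_injOn hs hinj) hd hs
  have h2 : ∃ᶠ ζ in 𝓝[≠] f z₀, ζ ∈ ({f z₀}ᶜ : Set ℂ) := eventually_mem_nhdsWithin.frequently
  obtain ⟨ζ, hζ, h⟩ := (h2.and_eventually (h1.filter_mono nhdsWithin_le_nhds)).exists
  obtain ⟨x, hx, y, hy, hxy, rfl, e⟩ := h hζ
  exact hxy (hinj hx hy e.symm)

/-- Injectivity makes the derivative nonzero, so every left inverse agrees locally with the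
holomorphic inverse function, even one picked pointwise by choice. -/
theorem image_open_and_differentiableOn_leftInv {f g : ℂ → ℂ} {A : Set ℂ} (hA : IsOpen A)
    (hf : DifferentiableOn ℂ f A) (hinj : InjOn f A) (hg : LeftInvOn g f A) :
    IsOpen (f '' A) ∧ DifferentiableOn ℂ g (f '' A) := by
  have key : ∀ z ∈ A, ∃ d : ℂ, d ≠ 0 ∧ HasStrictDerivAt f d z := fun z hz =>
    have ha := hf.analyticAt (hA.mem_nhds hz)
    ⟨_, deriv_ne_zero_of_injOn ha (hA.mem_nhds hz) hinj, ha.hasStrictDerivAt⟩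
  constructor
  · rw [isOpen_iff_mem_nhds]
    rintro _ ⟨z, hz, rfl⟩
    obtain ⟨d, hd, h⟩ := key z hz
    rw [← h.map_nhds_eq hd]
    exact image_mem_map (hA.mem_nhds hz)
  · rintro _ ⟨z, hz, rfl⟩
    obtain ⟨d, hd, h⟩ := key z hz
    have : ∀ᶠ x in 𝓝 z, g (f x) = x := by
      filter_upwards [hA.mem_nhds hz] with x hx using hg hx
    exact (h.to_local_left_inverse hd this).hasDerivAt.differentiableAt.differentiableWithinAt

/-! ### The maximum principle for harmonic functions -/

/-- Locally `G` is the real part of a holomorphic `F`, and `‖exp F‖ = exp G`, so the maximum modulus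
principle applies. -/
theorem harmonic_eventually_eq_of_isLocalMax {G : ℂ → ℝ} {z : ℂ} (hG : HarmonicAt G z)
    (hz : IsLocalMax G z) : ∀ᶠ w in 𝓝 z, G w = G z := by
  obtain ⟨r, hr, hball⟩ := Metric.eventually_nhds_iff_ball.1 hG.eventually
  obtain ⟨F, hF, hFG⟩ := HarmonicOnNhd.exists_analyticOnNhd_ball_re_eq (f := G) (z := z) (R := r)
    hball
  have hb : ball z r ∈ 𝓝 z := ball_mem_nhds z hr
  have h1 : ∀ᶠ w in 𝓝 z, DifferentiableAt ℂ (fun w => Complex.exp (F w)) w := by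
    filter_upwards [hb] with w hw using (hF w hw).differentiableAt.cexp
  have h2 : IsLocalMax (norm ∘ fun w => Complex.exp (F w)) z := by
    filter_upwards [hb, hz] with w hw hwz
    have e1 := hFG hw
    have e2 := hFG (mem_ball_self hr)
    simp only [Function.comp, Complex.norm_exp] at *
    rw [e1, e2]
    exact Real.exp_le_exp.2 hwz
  filter_upwards [Complex.eventually_eq_of_isLocalMax_norm h1 h2, hb] with w hw hwb
  have e1 := hFG hwb
  have e2 := hFG (mem_ball_self hr)
  have := congrArg norm hw
  simp only [Complex.norm_exp] at *
  rw [e1, e2] at this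
  exact Real.exp_injective this

/-- Compactness of the superlevel sets encodes boundary values `≤ 0`, including at infinity when `D`
is unbounded. -/
theorem harmonic_nonpos_of_isCompact {G : ℂ → ℝ} {D : Set ℂ} (hD : IsOpen D)
    (hG : HarmonicOnNhd G D) (hc : ∀ ε > 0, IsCompact {w ∈ D | ε ≤ G w}) {w : ℂ} (hw : w ∈ D) :
    G w ≤ 0 := by
  by_contra! hpos
  have hcont : ContinuousOn G D := hG.contDiffOn.continuousOn
  set C := {x ∈ D | G w ≤ G x} with hC
  have hCc : IsCompact C := hc _ hpos
  obtain ⟨p, hp, hpmax⟩ := hCc.exists_isMaxOn ⟨w, hw, le_rfl⟩ (hcont.mono fun x hx => hx.1)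
  -- The set where the maximum is attained is compact, so it has a rightmost point `q`; but `G` is
  -- constant near `q`, so `Q` also contains points further right.
  set Q := {x ∈ D | G p ≤ G x} with hQ
  have hQc : IsCompact Q := hc _ (hpos.trans_le hp.2)
  obtain ⟨q, hq, hqmax⟩ := hQc.exists_isMaxOn ⟨p, hp.1, le_rfl⟩ Complex.continuous_re.continuousOn
  have hmax : ∀ x ∈ D, G x ≤ G q := fun x hx => by
    by_cases h : G w ≤ G x
    · exact (hpmax ⟨hx, h⟩).trans hq.2
    · exact (not_le.1 h).le.trans (hp.2.trans hq.2)
  have hloc : IsLocalMax G q := by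
    filter_upwards [hD.mem_nhds hq.1] with x hx using hmax x hx
  have hev : ∀ᶠ x in 𝓝 q, x ∈ Q := by
    filter_upwards [harmonic_eventually_eq_of_isLocalMax (hG q hq.1) hloc, hD.mem_nhds hq.1]
      with x hx hxD
    exact ⟨hxD, hx ▸ hq.2⟩
  obtain ⟨r, hr, hball⟩ := Metric.eventually_nhds_iff_ball.1 hev
  have hmem : q + (r / 2 : ℝ) ∈ ball q r := by
    simp only [mem_ball, dist_self_add_left, Complex.norm_real, Real.norm_eq_abs]
    rw [abs_of_pos (by positivity)]; linarith
  have := hqmax (hball _ hmem)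
  simp at this
  linarith

theorem harmonic_eq_of_frontier {G : ℂ → ℝ} {D : Set ℂ} {k : ℝ} (hD : IsOpen D)
    (hb : IsBounded D) (hG : HarmonicOnNhd G D) (hcont : ContinuousOn G (closure D))
    (hfr : ∀ w ∈ frontier D, G w = k) {w : ℂ} (hw : w ∈ D) : G w = k := by
  have hcl : IsCompact (closure D) := hb.isCompact_closure
  have key : ∀ H : ℂ → ℝ, HarmonicOnNhd H D → ContinuousOn H (closure D) →
      (∀ w ∈ frontier D, H w = 0) → H w ≤ 0 := by
    intro H hH hHc hH0
    refine harmonic_nonpos_of_isCompact hD hH (fun ε hε => ?_) hw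
    have : {x ∈ D | ε ≤ H x} = closure D ∩ H ⁻¹' Ici ε := by
      ext x
      refine ⟨fun hx => ⟨subset_closure hx.1, hx.2⟩, fun hx => ⟨?_, hx.2⟩⟩
      by_contra hxD
      have h0 := hH0 x (by rw [frontier, hD.interior_eq]; exact ⟨hx.1, hxD⟩)
      have h1 : ε ≤ H x := hx.2
      linarith
    rw [this]
    exact hcl.of_isClosed_subset (hHc.preimage_isClosed_of_isClosed isClosed_closure isClosed_Ici)
      inter_subset_left
  have hconst : ∀ c : ℝ, HarmonicOnNhd (fun _ : ℂ => c) D := fun c z _ =>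
    (analyticAt_const (v := (c : ℂ))).harmonicAt_re
  have h1 := key (fun w => G w - k) (hG.sub (hconst k)) (hcont.sub continuousOn_const)
    (fun w hw => by simp [hfr w hw])
  have h2 := key (fun w => k - G w) ((hconst k).sub hG) (continuousOn_const.sub hcont)
    (fun w hw => by simp [hfr w hw])
  linarith

/-! ### Unicoherence of the plane -/

/-- If `A ∩ B` split into open pieces `P` and `Q`, the circle map equal to `exp (2πiφ)` on `P` and
`1` elsewhere would be continuous on the plane, hence have a real lift `F`. Now `F / 2π` differs by
a constant from `α` on `A` and from `β` on `B`. On `Q` both functions vanish, so the constants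
agree; on `P` they differ by `1`, a contradiction. -/
theorem isPreconnected_inter_of_union_eq_univ {A B : Set ℂ} (hA : IsOpen A) (hB : IsOpen B)
    (hAc : IsPreconnected A) (hBc : IsPreconnected B) (hAB : A ∪ B = univ) :
    IsPreconnected (A ∩ B) := by
  intro u v hu hv huv hPne hQne
  by_contra hemp
  rw [not_nonempty_iff_eq_empty] at hemp
  have hdisj : ∀ z, z ∈ A → z ∈ B → z ∈ u → z ∈ v → False := fun z h1 h2 h3 h4 => by
    have : z ∈ A ∩ B ∩ (u ∩ v) := ⟨⟨h1, h2⟩, h3, h4⟩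
    rw [hemp] at this
    exact this
  obtain ⟨φ, hφ0, hφ1, -⟩ := exists_continuous_zero_one_of_isClosed hB.isClosed_compl
    hA.isClosed_compl (by
      rw [Set.disjoint_left]
      intro z hzB hzA
      rcases hAB.symm ▸ mem_univ z with h | h
      exacts [hzA h, hzB h])
  set P := A ∩ B ∩ u with hP
  set Q := A ∩ B ∩ v with hQ
  have hPo : IsOpen P := (hA.inter hB).inter hu
  have hQo : IsOpen Q := (hA.inter hB).inter hv
  have hcont : ∀ ψ : ℂ → ℝ, Continuous ψ → ∀ x, (ψ x = 0 ∨ x ∈ P ∨ x ∈ Q) →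
      ContinuousAt (P.indicator ψ) x := by
    rintro ψ hψ x (h | h | h)
    · have hx : P.indicator ψ x = 0 := by
        by_cases hxP : x ∈ P
        · rw [indicator_of_mem hxP, h]
        · rw [indicator_of_notMem hxP]
      rw [ContinuousAt, hx]
      refine squeeze_zero_norm (fun z => norm_indicator_le_norm_self ψ z) ?_
      have := (hψ.norm).tendsto x
      rwa [h, norm_zero] at this
    · refine hψ.continuousAt.congr ?_
      filter_upwards [hPo.mem_nhds h] with z hz using (indicator_of_mem hz ψ).symm
    · refine (continuousAt_const (y := (0 : ℝ))).congr ?_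
      filter_upwards [hQo.mem_nhds h] with z hz
      rw [indicator_of_notMem]
      exact fun hzP => hdisj z hz.1.1 hz.1.2 hzP.2 hz.2
  have hPQ : ∀ z, z ∈ A → z ∈ B → z ∈ P ∨ z ∈ Q := fun z h1 h2 => by
    rcases huv ⟨h1, h2⟩ with h | h
    exacts [Or.inl ⟨⟨h1, h2⟩, h⟩, Or.inr ⟨⟨h1, h2⟩, h⟩]
  -- As `φ = 0` off `B` and `φ = 1` off `A`, `α` is continuous at points of `A` and `β` at points of
  -- `B`.
  set α : ℂ → ℝ := P.indicator φ with hα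
  set β : ℂ → ℝ := P.indicator (fun z => φ z - 1) with hβ
  have hαc : ∀ x ∈ A, ContinuousAt α x := fun x hx => hcont φ φ.continuous x (by
    by_cases hxB : x ∈ B
    · exact Or.inr (hPQ x hx hxB)
    · exact Or.inl (hφ0 hxB))
  have hβc : ∀ x ∈ B, ContinuousAt β x := fun x hx => hcont _ (φ.continuous.sub continuous_const) x
    (by
      by_cases hxA : x ∈ A
      · exact Or.inr (hPQ x hxA hx)
      · refine Or.inl ?_
        have := hφ1 hxA
        simp only [Pi.one_apply] at this
        exact sub_eq_zero.2 this)
  have hexp : ∀ z, Circle.exp (2 * Real.pi * α z) = Circle.exp (2 * Real.pi * β z) := fun z => by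
    by_cases hz : z ∈ P
    · rw [hα, hβ, indicator_of_mem hz, indicator_of_mem hz, Circle.exp_eq_exp]
      exact ⟨1, by push_cast; ring⟩
    · rw [hα, hβ, indicator_of_notMem hz, indicator_of_notMem hz]
  have hh : Continuous fun z => Circle.exp (2 * Real.pi * α z) := by
    rw [continuous_iff_continuousAt]
    intro x
    rcases hAB.symm ▸ mem_univ x with h | h
    · exact Circle.exp.continuous.continuousAt.comp (continuousAt_const.mul (hαc x h))
    · simp_rw [hexp]
      exact Circle.exp.continuous.continuousAt.comp (continuousAt_const.mul (hβc x h))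
  obtain ⟨F, ⟨-, hF⟩, -⟩ := Circle.isCoveringMap_exp.existsUnique_continuousMap_lifts
    ⟨_, hh⟩ (a₀ := (0 : ℂ)) (e₀ := 2 * Real.pi * α 0) rfl
  have hF' : ∀ z, Circle.exp (F z) = Circle.exp (2 * Real.pi * α z) := fun z => congrFun hF z
  have hconst : ∀ (γ : ℂ → ℝ) (S : Set ℂ), IsPreconnected S → (∀ x ∈ S, ContinuousAt γ x) →
      (∀ z, Circle.exp (F z) = Circle.exp (2 * Real.pi * γ z)) →
      ∃ k : ℝ, ∀ z ∈ S, F z = 2 * Real.pi * (γ z + k) := by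
    intro γ S hS hγ hγF
    have hd : IsDiscrete (range ((↑) : ℤ → ℝ)) :=
      Int.isClosedEmbedding_coe_real.isEmbedding.isDiscrete_range
    obtain ⟨k, -, hk⟩ := hS.eqOn_const_of_mapsTo
      (f := fun z => F z / (2 * Real.pi) - γ z) (T := range ((↑) : ℤ → ℝ)) hd
      (fun x hx => ((F.continuous.continuousAt.div_const _).sub (hγ x hx)).continuousWithinAt)
      (fun x _ => by
        obtain ⟨m, hm⟩ := Circle.exp_eq_exp.1 (hγF x)
        refine ⟨m, ?_⟩
        simp only
        rw [hm]
        field_simp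
        ring) ⟨_, mem_range_self 0⟩
    refine ⟨k, fun z hz => ?_⟩
    have := hk hz
    simp only [Function.const] at this
    rw [← this]
    field_simp
    ring
  obtain ⟨k, hk⟩ := hconst α A hAc hαc hF'
  obtain ⟨l, hl⟩ := hconst β B hBc hβc fun z => (hF' z).trans (hexp z)
  obtain ⟨p, hp⟩ := hPne
  obtain ⟨q, hq⟩ := hQne
  have hqP : q ∉ P := fun h => hdisj q hq.1.1 hq.1.2 h.2 hq.2
  have e1 := (hk q hq.1.1).symm.trans (hl q hq.1.2)
  have e2 := (hk p hp.1.1).symm.trans (hl p hp.1.2)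
  have hpi : (2 * Real.pi) ≠ 0 := by positivity
  have e1' := mul_left_cancel₀ hpi e1
  have e2' := mul_left_cancel₀ hpi e2
  rw [hα, hβ, indicator_of_notMem hqP, indicator_of_notMem hqP] at e1'
  rw [hα, hβ, indicator_of_mem hp, indicator_of_mem hp] at e2'
  linarith

theorem isPreconnected_norm_gt (R : ℝ) : IsPreconnected {w : ℂ | R < ‖w‖} := by
  rcases lt_or_ge R 0 with hR | hR
  · convert isPreconnected_univ (α := ℂ)
    ext w
    simp only [mem_ofPred_eq, mem_univ, iff_true]
    exact hR.trans_le (norm_nonneg w)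
  have : {w : ℂ | R < ‖w‖} = (fun p : ℝ × Circle => ((p.1 : ℝ) : ℂ) * p.2) '' (Ioi R ×ˢ univ) := by
    ext w
    simp only [mem_ofPred_eq, mem_image, mem_prod, mem_Ioi, mem_univ, and_true, Prod.exists]
    constructor
    · intro hw
      have hw0 : w ≠ 0 := norm_pos_iff.1 (hR.trans_lt hw)
      exact ⟨‖w‖, Circle.exp w.arg, hw, by simp⟩
    · rintro ⟨x, y, hx, rfl⟩
      rwa [norm_mul, Circle.norm_coe, mul_one, Complex.norm_real, Real.norm_eq_abs,
        abs_of_pos (hR.trans_lt hx)]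
  rw [this]
  refine (isPreconnected_Ioi.prod ?_).image _ (by fun_prop)
  have : (univ : Set Circle) = range Circle.exp := by
    rw [eq_comm, range_eq_univ]
    exact fun z => ⟨Complex.arg z, Circle.exp_arg z⟩
  rw [this]
  exact isPreconnected_range Circle.exp.continuous

/-! ### Normalized conformal maps between neighbourhoods of infinity -/

/-- `f` is a conformal bijection from `A` onto `B`, two open neighbourhoods of infinity, with
`f z - z → 0` at infinity. -/
structure NormalizedConformal (f : ℂ → ℂ) (A B : Set ℂ) : Prop where
  isOpen : IsOpen A
  mem_cobounded : A ∈ cobounded ℂ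
  bijOn : BijOn f A B
  differentiableOn : DifferentiableOn ℂ f A
  tendsto_sub : Tendsto (fun z => f z - z) (cobounded ℂ) (𝓝 0)

namespace NormalizedConformal

variable {f g : ℂ → ℂ} {A B C : Set ℂ}

theorem tendsto_cobounded_of_sub (h : Tendsto (fun z => f z - z) (cobounded ℂ) (𝓝 0)) :
    Tendsto f (cobounded ℂ) (cobounded ℂ) := by
  rw [← tendsto_norm_atTop_iff_cobounded]
  have h1 : Tendsto (fun z : ℂ => ‖z‖ - 1) (cobounded ℂ) atTop :=
    tendsto_atTop_add_const_right _ _ tendsto_norm_cobounded_atTop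
  refine tendsto_atTop_mono' _ ?_ h1
  filter_upwards [(tendsto_zero_iff_norm_tendsto_zero.1 h).eventually (gt_mem_nhds one_pos)]
    with z hz
  have : ‖z‖ ≤ ‖f z‖ + ‖f z - z‖ := by
    calc ‖z‖ = ‖f z - (f z - z)‖ := by rw [sub_sub_cancel]
      _ ≤ _ := norm_sub_le _ _
  linarith

theorem isOpen_image (h : NormalizedConformal f A B) : IsOpen B := by
  rw [← h.bijOn.image_eq]
  exact (image_open_and_differentiableOn_leftInv h.isOpen h.differentiableOn h.bijOn.injOn
    h.bijOn.injOn.leftInvOn_invFunOn).1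

/-- A normalized map hits every point `w` near infinity, at a point close to `w`. -/
theorem eventually_exists_preimage (h : NormalizedConformal f A B) :
    ∀ᶠ w in cobounded ℂ, ∃ z ∈ A, ‖z - w‖ ≤ 1 ∧ f z = w := by
  -- With error `1/6`, `f` moves the unit circle about `w` at least `1/3` away from `f w`, and the
  -- quantitative open mapping theorem then covers the ball of radius `1/6` about `f w`, which
  -- contains `w`.
  have h1 : {z | z ∈ A ∧ ‖f z - z‖ < 1 / 6} ∈ cobounded ℂ :=
    inter_mem h.mem_cobounded
      ((tendsto_zero_iff_norm_tendsto_zero.1 h.tendsto_sub).eventually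
        (gt_mem_nhds (by norm_num : (0 : ℝ) < 1 / 6)))
  obtain ⟨R, hR⟩ := (hasBasis_cobounded_norm (E := ℂ)).mem_iff.1 h1
  have hR' : ∀ z : ℂ, R ≤ ‖z‖ → z ∈ A ∧ ‖f z - z‖ < 1 / 6 := fun z hz => hR.2 hz
  filter_upwards [(hasBasis_cobounded_norm (E := ℂ)).mem_of_mem (i := R + 1) trivial] with w hw
  have hw' : R + 1 ≤ ‖w‖ := hw
  have hball : ∀ z ∈ closedBall w 1, R ≤ ‖z‖ := fun z hz => by
    have h2 : ‖w‖ ≤ ‖z‖ + ‖z - w‖ := by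
      calc ‖w‖ = ‖z - (z - w)‖ := by rw [sub_sub_cancel]
        _ ≤ _ := norm_sub_le _ _
    rw [mem_closedBall_iff_norm] at hz
    linarith
  have hd : DiffContOnCl ℂ f (ball w 1) := by
    refine DifferentiableOn.diffContOnCl ?_
    refine h.differentiableOn.mono fun z hz => (hR' z (hball z ?_)).1
    exact closure_ball_subset_closedBall hz
  have hwR := hR' w (hball w (mem_closedBall_self zero_le_one))
  have hfreq : ∃ᶠ z in 𝓝 w, f z ≠ f w :=
    not_eventually.1 (not_eventually_eq_of_injOn (h.isOpen.mem_nhds hwR.1) h.bijOn.injOn)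
  have hsph : ∀ z ∈ sphere w 1, (1 / 3 : ℝ) ≤ ‖f z - f w‖ := fun z hz => by
    have h3 := (hR' z (hball z (sphere_subset_closedBall hz))).2
    have h4 : ‖z - w‖ = 1 := by rwa [mem_sphere_iff_norm] at hz
    have h5 : ‖z - w‖ ≤ ‖f z - f w‖ + ‖f z - z‖ + ‖f w - w‖ := by
      calc ‖z - w‖ = ‖(f z - f w) - (f z - z) + (f w - w)‖ := by ring_nf
        _ ≤ _ := (norm_add_le _ _).trans (by gcongr; exact norm_sub_le _ _)
    linarith [hwR.2]
  have hmem : w ∈ ball (f w) (1 / 3 / 2) := by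
    rw [mem_ball_iff_norm, norm_sub_rev]
    linarith [hwR.2]
  obtain ⟨z, hz, hzw⟩ := hd.ball_subset_image_closedBall one_pos hsph hfreq hmem
  exact ⟨z, (hR' z (hball z hz)).1, mem_closedBall_iff_norm.1 hz, hzw⟩

theorem image_mem_cobounded (h : NormalizedConformal f A B) : B ∈ cobounded ℂ := by
  filter_upwards [h.eventually_exists_preimage] with w ⟨z, hz, _, hzw⟩
  exact hzw ▸ h.bijOn.mapsTo hz

theorem of_leftInvOn (h : NormalizedConformal f A B) (hg : InvOn g f A B) (hgm : MapsTo g B A) :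
    NormalizedConformal g B A where
  isOpen := h.isOpen_image
  mem_cobounded := h.image_mem_cobounded
  bijOn := (hg.symm).bijOn hgm h.bijOn.mapsTo
  differentiableOn := by
    rw [← h.bijOn.image_eq]
    exact (image_open_and_differentiableOn_leftInv h.isOpen h.differentiableOn h.bijOn.injOn
      hg.1).2
  tendsto_sub := by
    -- Since `g w` stays within `1` of `w`, it tends to infinity, and `g w - w` is minus the error
    -- `f z - z` at `z = g w`.
    have hnear : ∀ᶠ w in cobounded ℂ, w ∈ B ∧ ‖g w - w‖ ≤ 1 := by
      filter_upwards [h.eventually_exists_preimage] with w ⟨z, hz, hzw, e⟩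
      subst e
      exact ⟨h.bijOn.mapsTo hz, by rwa [hg.1 hz]⟩
    have hgt : Tendsto g (cobounded ℂ) (cobounded ℂ) := by
      rw [← tendsto_norm_atTop_iff_cobounded]
      have h1 : Tendsto (fun z : ℂ => ‖z‖ - 1) (cobounded ℂ) atTop :=
        tendsto_atTop_add_const_right _ _ tendsto_norm_cobounded_atTop
      refine tendsto_atTop_mono' _ ?_ h1
      filter_upwards [hnear] with z hz
      have : ‖z‖ ≤ ‖g z‖ + ‖g z - z‖ := by
        calc ‖z‖ = ‖g z - (g z - z)‖ := by rw [sub_sub_cancel]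
          _ ≤ _ := norm_sub_le _ _
      linarith [hz.2]
    have h2 := (h.tendsto_sub.comp hgt).neg
    rw [neg_zero] at h2
    refine h2.congr' ?_
    filter_upwards [hnear] with w hw
    simp only [Function.comp]
    rw [hg.2 hw.1]
    ring

theorem symm (h : NormalizedConformal f A B) : NormalizedConformal (Function.invFunOn f A) B A :=
  h.of_leftInvOn h.bijOn.invOn_invFunOn h.bijOn.surjOn.mapsTo_invFunOn

theorem comp (hg : NormalizedConformal g B C) (hf : NormalizedConformal f A B) :
    NormalizedConformal (g ∘ f) A C where
  isOpen := hf.isOpen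
  mem_cobounded := hf.mem_cobounded
  bijOn := hg.bijOn.comp hf.bijOn
  differentiableOn := hg.differentiableOn.comp hf.differentiableOn hf.bijOn.mapsTo
  tendsto_sub := by
    have h := (hg.tendsto_sub.comp (tendsto_cobounded_of_sub hf.tendsto_sub)).add hf.tendsto_sub
    rw [add_zero] at h
    refine h.congr fun z => ?_
    simp only [Function.comp]
    ring

/-- The image of a relatively closed subset of the plane is closed in the plane. -/
theorem isClosed_image (h : NormalizedConformal f A B) {S : Set ℂ} (hS : IsClosed S)
    (hSA : S ⊆ A) : IsClosed (f '' S) := by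
  have hcont : ContinuousOn f S := h.differentiableOn.continuousOn.mono hSA
  refine isClosed_of_closure_subset fun w hw => ?_
  obtain ⟨u, huS, hu⟩ := mem_closure_iff_seq_limit.1 hw
  choose x hxS hx using huS
  -- If the preimages escaped to infinity, so would their images, which converge to `w`.
  have hbdd : ∃ R, ∃ᶠ k in atTop, ‖x k‖ ≤ R := by
    by_contra! hcon
    have h1 : Tendsto x atTop (cobounded ℂ) := by
      rw [← tendsto_norm_atTop_iff_cobounded, Filter.tendsto_atTop]
      intro R
      filter_upwards [hcon R] with k hk using hk.le
    have h2 := (tendsto_cobounded_of_sub h.tendsto_sub).comp h1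
    have h3 : f ∘ x = u := funext hx
    rw [h3] at h2
    exact (hu.not_tendsto (disjoint_nhds_cobounded w)) h2
  obtain ⟨R, hR⟩ := hbdd
  obtain ⟨φ, hφ, hφR⟩ := extraction_of_frequently_atTop hR
  obtain ⟨z, hz, ψ, hψ, hlim⟩ := ((isCompact_closedBall (0 : ℂ) R).inter_right hS).tendsto_subseq
    (x := x ∘ φ) fun k => ⟨by simpa using hφR k, hxS _⟩
  refine ⟨z, hz.2, ?_⟩
  have h4 : Tendsto (fun k => f (x (φ (ψ k)))) atTop (𝓝 (f z)) :=
    (hcont z hz.2).tendsto.comp (tendsto_nhdsWithin_iff.2 ⟨hlim, Eventually.of_forall fun k => hxS _⟩)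
  simp_rw [hx] at h4
  exact tendsto_nhds_unique h4 (hu.comp (hφ.comp hψ).tendsto_atTop)

end NormalizedConformal

/-- Components of an open plane set are open, so a point of `S` adherent to one of them belongs to
it. Frontier points of a component therefore lie outside `S`. -/
theorem closure_connectedComponentIn_inter_subset {S : Set ℂ} (hS : IsOpen S) (x : ℂ) :
    closure (connectedComponentIn S x) ∩ S ⊆ connectedComponentIn S x := by
  rintro y ⟨hy, hyS⟩
  obtain ⟨z, hzy, hzx⟩ := _root_.mem_closure_iff.1 hy _ hS.connectedComponentIn
    (mem_connectedComponentIn hyS)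
  rw [connectedComponentIn_eq hzx, ← connectedComponentIn_eq hzy]
  exact mem_connectedComponentIn hyS

/-! ### The modulus of the generalized lemniscate function -/

/-- The function `w ↦ ∏ j, |w - a j| ^ m j` whose superlevel sets are lemniscatic domains. -/
noncomputable def lemMod {n : ℕ} (a : Fin n → ℂ) (m : Fin n → ℝ) (w : ℂ) : ℝ :=
  ∏ j, ‖w - a j‖ ^ m j

section

variable {n : ℕ} {a : Fin n → ℂ} {m : Fin n → ℝ}

theorem lemMod_nonneg (w : ℂ) : 0 ≤ lemMod a m w :=
  Finset.prod_nonneg fun _ _ => Real.rpow_nonneg (norm_nonneg _) _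

theorem continuous_lemMod (hm : ∀ j, 0 < m j) : Continuous (lemMod a m) :=
  continuous_finsetProd _ fun j _ =>
    ((continuous_id.sub continuous_const).norm).rpow_const fun _ => Or.inr (hm j).le

theorem lemMod_eq_zero_iff (hm : ∀ j, 0 < m j) {w : ℂ} : lemMod a m w = 0 ↔ ∃ j, w = a j := by
  simp only [lemMod, Finset.prod_eq_zero_iff, Finset.mem_univ, true_and,
    Real.rpow_eq_zero_iff_of_nonneg (norm_nonneg _), norm_eq_zero, sub_eq_zero]
  exact exists_congr fun j => and_iff_left (hm j).ne'

theorem lemMod_focus (hm : ∀ j, 0 < m j) (j : Fin n) : lemMod a m (a j) = 0 :=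
  (lemMod_eq_zero_iff hm).2 ⟨j, rfl⟩

theorem log_lemMod (hm : ∀ j, 0 < m j) {w : ℂ} (hw : lemMod a m w ≠ 0) :
    Real.log (lemMod a m w) = ∑ j, m j * Real.log ‖w - a j‖ := by
  have hne : ∀ j, 0 < ‖w - a j‖ := fun j => by
    rw [norm_pos_iff, sub_ne_zero]
    exact fun h => hw ((lemMod_eq_zero_iff hm).2 ⟨j, h⟩)
  rw [lemMod, Real.log_prod (fun j _ => (Real.rpow_pos_of_pos (hne j) _).ne')]
  exact Finset.sum_congr rfl fun j _ => Real.log_rpow (hne j) _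

theorem tendsto_lemMod (hm : ∀ j, 0 < m j) (hsum : ∑ j, m j = 1) :
    Tendsto (lemMod a m) (cobounded ℂ) atTop := by
  obtain ⟨R, hR⟩ : ∃ R, ∀ j, ‖a j‖ ≤ R := by
    obtain ⟨R, hR⟩ := (finite_range fun j => ‖a j‖).bddAbove
    exact ⟨R, fun j => hR (mem_range_self j)⟩
  have h1 : Tendsto (fun z : ℂ => ‖z‖ - R) (cobounded ℂ) atTop :=
    tendsto_atTop_add_const_right _ _ tendsto_norm_cobounded_atTop
  refine tendsto_atTop_mono' _ ?_ h1
  filter_upwards [h1.eventually_gt_atTop 0] with w hw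
  calc ‖w‖ - R = ∏ j, (‖w‖ - R) ^ m j := by
        rw [← Real.rpow_sum_of_pos hw, hsum, Real.rpow_one]
    _ ≤ lemMod a m w := by
        refine Finset.prod_le_prod (fun _ _ => Real.rpow_nonneg hw.le _) fun j _ => ?_
        refine Real.rpow_le_rpow hw.le ?_ (hm j).le
        linarith [norm_sub_norm_le w (a j), hR j]

theorem isBounded_lemMod_le (hm : ∀ j, 0 < m j) (hsum : ∑ j, m j = 1) (c : ℝ) :
    IsBounded {w | lemMod a m w ≤ c} := by
  rw [← isCobounded_compl_iff, isCobounded_def]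
  filter_upwards [(tendsto_lemMod (a := a) hm hsum).eventually_gt_atTop c] with w hw
  exact not_le.2 hw

theorem isCompact_lemMod_le (hm : ∀ j, 0 < m j) (hsum : ∑ j, m j = 1) (c : ℝ) :
    IsCompact {w | lemMod a m w ≤ c} :=
  isCompact_of_isClosed_isBounded (isClosed_le (continuous_lemMod hm) continuous_const)
    (isBounded_lemMod_le hm hsum c)

theorem isOpen_lemMod_lt (hm : ∀ j, 0 < m j) (c : ℝ) : IsOpen {w | lemMod a m w < c} :=
  isOpen_lt (continuous_lemMod hm) continuous_const

theorem isOpen_lt_lemMod (hm : ∀ j, 0 < m j) (c : ℝ) : IsOpen {w | c < lemMod a m w} :=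
  isOpen_lt continuous_const (continuous_lemMod hm)

theorem harmonicAt_log_lemMod_comp (hm : ∀ j, 0 < m j) {f : ℂ → ℂ} {z : ℂ}
    (hf : AnalyticAt ℂ f z) (hz : lemMod a m (f z) ≠ 0) :
    HarmonicAt (fun w => Real.log (lemMod a m (f w))) z := by
  have hev : (fun w => Real.log (lemMod a m (f w))) =ᶠ[𝓝 z]
      fun w => ∑ j, m j * Real.log ‖f w - a j‖ := by
    have hc : ContinuousAt (fun w => lemMod a m (f w)) z :=
      (continuous_lemMod hm).continuousAt.comp hf.continuousAt
    filter_upwards [hc.eventually_ne hz] with w hw using log_lemMod hm hw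
  rw [harmonicAt_congr_nhds hev]
  have hterm : ∀ j, HarmonicAt (fun w => m j * Real.log ‖f w - a j‖) z := fun j => by
    have h1 : HarmonicAt (fun w => Real.log ‖f w - a j‖) z :=
      (hf.sub analyticAt_const).harmonicAt_log_norm
        (sub_ne_zero.2 fun h => hz ((lemMod_eq_zero_iff hm).2 ⟨j, h⟩))
    exact h1.const_smul (c := m j)
  have hs : ∀ s : Finset (Fin n),
      HarmonicAt (fun w => ∑ j ∈ s, m j * Real.log ‖f w - a j‖) z := by
    intro s
    induction s using Finset.cons_induction with
    | empty =>
      simp only [Finset.sum_empty]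
      exact (analyticAt_const (v := (0 : ℂ)) (x := z)).harmonicAt_re
    | cons j s hj ih =>
      simp only [Finset.sum_cons]
      exact (hterm j).add ih
  exact hs _

/-! ### Components of sublevel and superlevel sets -/

/-- Off the foci `log (lemMod a m)` is harmonic, so constant boundary values propagate inside. -/
theorem lemMod_eq_of_frontier (hm : ∀ j, 0 < m j) {D : Set ℂ} {k : ℝ}
    (hD : IsOpen D) (hb : IsBounded D) (hk : 0 < k) (hfr : ∀ w ∈ frontier D, lemMod a m w = k)
    (hfoci : ∀ j, a j ∉ D) {w : ℂ} (hw : w ∈ D) : lemMod a m w = k := by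
  have hne : ∀ x ∈ closure D, lemMod a m x ≠ 0 := by
    intro x hx h0
    by_cases hxD : x ∈ D
    · obtain ⟨j, rfl⟩ := (lemMod_eq_zero_iff hm).1 h0
      exact hfoci j hxD
    · have := hfr x (by rw [frontier, hD.interior_eq]; exact ⟨hx, hxD⟩)
      linarith
  have h := harmonic_eq_of_frontier (G := fun w => Real.log (lemMod a m w)) (k := Real.log k)
    hD hb
    (fun x hx => harmonicAt_log_lemMod_comp hm analyticAt_id (hne x (subset_closure hx)))
    ((continuous_lemMod hm).continuousOn.log hne) (fun x hx => by simp only [hfr x hx]) hw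
  exact Real.log_injOn_pos ((lemMod_nonneg w).lt_of_ne' (hne w (subset_closure hw))) hk h

/-- On the frontier of a component the modulus equals `c`; without a focus inside, it would equal
`c` throughout. -/
theorem exists_focus_mem_component (hm : ∀ j, 0 < m j) (hsum : ∑ j, m j = 1) {c : ℝ} {x : ℂ}
    (hx : lemMod a m x < c) : ∃ j, a j ∈ connectedComponentIn {w | lemMod a m w < c} x := by
  by_contra! hcon
  set S := {w | lemMod a m w < c} with hSdef
  have hS : IsOpen S := isOpen_lemMod_lt hm c
  have hDS := connectedComponentIn_subset S x
  have h := lemMod_eq_of_frontier (a := a) hm (k := c) (hS.connectedComponentIn (x := x))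
    ((isBounded_lemMod_le hm hsum c).subset fun w hw => le_of_lt (show lemMod a m w < c from hDS hw))
    ((lemMod_nonneg x).trans_lt hx) (fun w hw => ?_) hcon (mem_connectedComponentIn hx)
  · exact hx.ne h
  · rw [frontier, hS.connectedComponentIn.interior_eq] at hw
    have h1 : lemMod a m w ≤ c :=
      closure_minimal (t := {w | lemMod a m w ≤ c})
        (fun w hw => le_of_lt (show lemMod a m w < c from hDS hw))
        (isClosed_le (continuous_lemMod hm) continuous_const) hw.1
    refine h1.antisymm (not_lt.1 fun h2 => hw.2 ?_)
    exact closure_connectedComponentIn_inter_subset hS x ⟨hw.1, h2⟩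

/-- A bounded component would have boundary value `μ` and contain no focus, so the modulus would be
constantly `μ` on it. Hence every component meets the connected region `R < ‖w‖`. -/
theorem isPreconnected_lt_lemMod (hm : ∀ j, 0 < m j) (hsum : ∑ j, m j = 1) {μ : ℝ} (hμ : 0 < μ) :
    IsPreconnected {w | μ < lemMod a m w} := by
  set S := {w | μ < lemMod a m w} with hSdef
  have hS : IsOpen S := isOpen_lt_lemMod hm μ
  obtain ⟨R, hR⟩ := (isBounded_lemMod_le (a := a) hm hsum μ).exists_norm_le
  have hRS : {w : ℂ | R < ‖w‖} ⊆ S := fun w hw =>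
    show μ < lemMod a m w from not_le.1 fun h => (hR w h).not_gt hw
  have hfar : ∀ y ∈ S, (connectedComponentIn S y ∩ {w : ℂ | R < ‖w‖}).Nonempty := by
    intro y hy
    by_contra hemp
    have hDS := connectedComponentIn_subset S y
    have hb : IsBounded (connectedComponentIn S y) := by
      refine isBounded_iff_forall_norm_le.2 ⟨R, fun w hw => not_lt.1 fun h => hemp ⟨w, hw, h⟩⟩
    have h := lemMod_eq_of_frontier (a := a) hm (k := μ) (hS.connectedComponentIn (x := y)) hb hμ
      (fun w hw => ?_) (fun j hj => ?_) (mem_connectedComponentIn hy)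
    · exact (ne_of_gt hy) h
    · rw [frontier, hS.connectedComponentIn.interior_eq] at hw
      have h1 : μ ≤ lemMod a m w :=
        closure_minimal (t := {w | μ ≤ lemMod a m w})
          (fun w hw => le_of_lt (show μ < lemMod a m w from hDS hw))
          (isClosed_le continuous_const (continuous_lemMod hm)) hw.1
      refine (h1.antisymm (not_lt.1 fun h2 => hw.2 ?_)).symm
      exact closure_connectedComponentIn_inter_subset hS y ⟨hw.1, h2⟩
    · have : μ < lemMod a m (a j) := hDS hj
      rw [lemMod_focus hm] at this
      exact hμ.not_gt this
  obtain ⟨p, hp⟩ : ∃ p : ℂ, R < ‖p‖ := NormedSpace.exists_lt_norm ℂ ℂ R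
  refine isPreconnected_of_forall p fun y hy => ?_
  exact ⟨connectedComponentIn S y ∪ {w : ℂ | R < ‖w‖},
    union_subset (connectedComponentIn_subset S y) hRS, Or.inr hp,
    Or.inl (mem_connectedComponentIn hy),
    isPreconnected_connectedComponentIn.union' (hfar y hy) (isPreconnected_norm_gt R)⟩

theorem isCompact_component_inter_le (hm : ∀ j, 0 < m j) (hsum : ∑ j, m j = 1) {c c' : ℝ}
    (hcc : c' < c) (x : ℂ) :
    IsCompact (connectedComponentIn {w | lemMod a m w < c} x ∩ {w | lemMod a m w ≤ c'}) := by
  have hS : IsOpen {w | lemMod a m w < c} := isOpen_lemMod_lt hm c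
  have hF := isCompact_lemMod_le (a := a) hm hsum c'
  have : connectedComponentIn {w | lemMod a m w < c} x ∩ {w | lemMod a m w ≤ c'} =
      closure (connectedComponentIn {w | lemMod a m w < c} x) ∩ {w | lemMod a m w ≤ c'} := by
    refine (inter_subset_inter_left _ subset_closure).antisymm fun w hw => ⟨?_, hw.2⟩
    exact closure_connectedComponentIn_inter_subset hS x
      ⟨hw.1, lt_of_le_of_lt (show lemMod a m w ≤ c' from hw.2) hcc⟩
  rw [this]
  exact hF.inter_left isClosed_closure

/-- The complement consists of the connected set `T` and the other components of the sublevel set.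
Each of these meets `T`, since otherwise it would be closed as well as open. -/
theorem isPreconnected_compl_component_inter_le (hm : ∀ j, 0 < m j) (hsum : ∑ j, m j = 1)
    {c c' : ℝ} (hc' : 0 < c') (hcc : c' < c) (x : ℂ) :
    IsPreconnected
      (connectedComponentIn {w | lemMod a m w < c} x ∩ {w | lemMod a m w ≤ c'})ᶜ := by
  set S := {w | lemMod a m w < c} with hSdef
  have hS : IsOpen S := isOpen_lemMod_lt hm c
  set T := {w | c' < lemMod a m w} with hT
  have hTc : IsPreconnected T := isPreconnected_lt_lemMod hm hsum hc'
  have hTsub : T ⊆ (connectedComponentIn S x ∩ {w | lemMod a m w ≤ c'})ᶜ :=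
    fun w hw h => (show lemMod a m w ≤ c' from h.2).not_gt hw
  obtain ⟨p, hp⟩ : ∃ p, p ∈ T :=
    ((tendsto_lemMod hm hsum).eventually_gt_atTop c').exists
  refine isPreconnected_of_forall p fun y hy => ?_
  by_cases hyT : y ∈ T
  · exact ⟨T, hTsub, hp, hyT, hTc⟩
  have hyc : lemMod a m y ≤ c' := not_lt.1 hyT
  have hyS : y ∈ S := hyc.trans_lt hcc
  have hyN : y ∉ connectedComponentIn S x := fun h => hy ⟨h, hyc⟩
  refine ⟨connectedComponentIn S y ∪ T, union_subset (fun w hw hwN => hyN ?_) hTsub, Or.inr hp,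
    Or.inl (mem_connectedComponentIn hyS),
    isPreconnected_connectedComponentIn.union' ?_ hTc⟩
  · rw [connectedComponentIn_eq hwN.1, ← connectedComponentIn_eq hw]
    exact mem_connectedComponentIn hyS
  · by_contra hemp
    have hsub : connectedComponentIn S y ⊆ {w | lemMod a m w ≤ c'} :=
      fun w hw => show lemMod a m w ≤ c' from not_lt.1 fun h => hemp ⟨w, hw, h⟩
    have hcl : IsClosed (connectedComponentIn S y) := by
      have := (isCompact_component_inter_le (a := a) hm hsum hcc y).isClosed
      rwa [inter_eq_left.2 hsub] at this
    have huniv := IsClopen.eq_univ ⟨hcl, hS.connectedComponentIn⟩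
      ⟨y, mem_connectedComponentIn hyS⟩
    exact hemp ⟨p, huniv ▸ mem_univ p, hp⟩

/-- Unicoherence, applied to the component and to the complement of its part at height `≤ μ`:
together they cover the plane. -/
theorem isPreconnected_component_inter_lt (hm : ∀ j, 0 < m j) (hsum : ∑ j, m j = 1)
    {c μ : ℝ} (hμ : 0 < μ) (hμc : μ < c) (x : ℂ) :
    IsPreconnected
      (connectedComponentIn {w | lemMod a m w < c} x ∩ {w | μ < lemMod a m w}) := by
  have h := isPreconnected_inter_of_union_eq_univ
    (isOpen_lemMod_lt (a := a) hm c).connectedComponentIn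
    (isCompact_component_inter_le (a := a) hm hsum hμc x).isClosed.isOpen_compl
    isPreconnected_connectedComponentIn
    (isPreconnected_compl_component_inter_le hm hsum hμ hμc x)
    (by
      ext w
      simp only [mem_union, mem_compl_iff, mem_inter_iff, mem_univ, iff_true]
      tauto)
  convert h using 1
  ext w
  simp only [mem_inter_iff, mem_compl_iff, mem_ofPred_eq, not_and, not_le]
  tauto

end

/-! ### Isolating the foci just above the critical level -/

theorem exists_pairwise_disjoint_open_nhds {ι : Type*} [Finite ι] {E : ι → Set ℂ}
    (hE : ∀ j, IsClosed (E j)) (hne : ∀ j, (E j).Nonempty)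
    (hdisj : ∀ i j, i ≠ j → Disjoint (E i) (E j)) :
    ∃ V : ι → Set ℂ, (∀ j, IsOpen (V j)) ∧ (∀ j, E j ⊆ V j) ∧
      ∀ i j, i ≠ j → Disjoint (V i) (V j) := by
  refine ⟨fun j => ⋂ l, ⋂ _ : l ≠ j, {w | infDist w (E j) < infDist w (E l)}, fun j => ?_,
    fun j w hw => ?_, fun i j hij => ?_⟩
  · refine isOpen_iInter_of_finite fun l => isOpen_iInter_of_finite fun _ => ?_
    exact isOpen_lt (continuous_infDist_pt _) (continuous_infDist_pt _)
  · simp only [mem_iInter, mem_ofPred_eq]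
    intro l hl
    rw [infDist_zero_of_mem hw]
    exact ((hE l).notMem_iff_infDist_pos (hne l)).1 fun h =>
      Set.disjoint_left.1 (hdisj l j hl) h hw
  · rw [Set.disjoint_left]
    intro w hi hj
    simp only [mem_iInter, mem_ofPred_eq] at hi hj
    exact lt_asymm (hi j hij.symm) (hj i hij)

variable {n : ℕ} {a : Fin n → ℂ} {m : Fin n → ℝ}

/-- If a lemniscatic domain with `n` foci is conformally equivalent to the complement of `n`
disjoint compact sets, then slightly above the critical level every component of a sublevel set
contains only one focus. -/
theorem exists_level_isolating_foci (hm : ∀ j, 0 < m j) (hsum : ∑ j, m j = 1) {μ : ℝ}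
    (hμ : 0 < μ) {E : Fin n → Set ℂ} (hE : ∀ j, IsCompact (E j)) (hne : ∀ j, (E j).Nonempty)
    (hdisj : ∀ i j, i ≠ j → Disjoint (E i) (E j)) {f : ℂ → ℂ}
    (hf : NormalizedConformal f (⋃ j, E j)ᶜ {w | μ < lemMod a m w}) :
    ∃ c, μ < c ∧ ∀ i l, a l ∈ connectedComponentIn {w | lemMod a m w < c} (a i) → l = i := by
  obtain ⟨V, hVo, hEV, hVd⟩ := exists_pairwise_disjoint_open_nhds (fun j => (hE j).isClosed) hne
    hdisj
  set A := (⋃ j, E j)ᶜ with hA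
  set B := {w | μ < lemMod a m w} with hB
  have hbij := hf.bijOn
  have hC : IsClosed (⋃ j, V j)ᶜ := (isOpen_iUnion hVo).isClosed_compl
  have hCA : (⋃ j, V j)ᶜ ⊆ A := compl_subset_compl.2 (iUnion_mono hEV)
  have hfC := hf.isClosed_image hC hCA
  -- a level `c` below the image of the complement of the neighbourhoods
  obtain ⟨c, hμc, hc⟩ : ∃ c, μ < c ∧ ∀ w ∈ B, lemMod a m w < c → w ∉ f '' (⋃ j, V j)ᶜ := by
    have hK : IsCompact (f '' (⋃ j, V j)ᶜ ∩ {w | lemMod a m w ≤ μ + 1}) :=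
      (isCompact_lemMod_le hm hsum _).inter_left hfC
    rcases (f '' (⋃ j, V j)ᶜ ∩ {w | lemMod a m w ≤ μ + 1}).eq_empty_or_nonempty with h | h
    · refine ⟨μ + 1, by linarith, fun w _ hw hwC => ?_⟩
      have : w ∈ f '' (⋃ j, V j)ᶜ ∩ {w | lemMod a m w ≤ μ + 1} := ⟨hwC, hw.le⟩
      rw [h] at this
      exact this
    · obtain ⟨p, hp, hpmin⟩ := hK.exists_isMinOn h (continuous_lemMod hm).continuousOn
      have hpB : p ∈ B := by
        obtain ⟨z, hz, rfl⟩ := hp.1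
        exact hbij.mapsTo (hCA hz)
      refine ⟨lemMod a m p, hpB, fun w _ hw hwC => ?_⟩
      have h2 : lemMod a m p ≤ lemMod a m w :=
        hpmin (show w ∈ f '' (⋃ j, V j)ᶜ ∩ {w | lemMod a m w ≤ μ + 1} from
          ⟨hwC, hw.le.trans hp.2⟩)
      exact h2.not_gt hw
  refine ⟨c, hμc, ?_⟩
  set S := {w | lemMod a m w < c} with hS
  set W : Fin n → Set ℂ := fun j => f '' (A ∩ V j) with hW
  have hWo : ∀ j, IsOpen (W j) := fun j =>
    (image_open_and_differentiableOn_leftInv (hf.isOpen.inter (hVo j))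
      (hf.differentiableOn.mono inter_subset_left) (hbij.injOn.mono inter_subset_left)
      (hbij.injOn.leftInvOn_invFunOn.mono inter_subset_left)).1
  have hWd : ∀ i j, i ≠ j → Disjoint (W i) (W j) := by
    intro i j hij
    rw [Set.disjoint_left]
    rintro _ ⟨z, hz, rfl⟩ ⟨z', hz', e⟩
    rw [hbij.injOn hz'.1 hz.1 e] at hz'
    exact Set.disjoint_left.1 (hVd i j hij) hz.2 hz'.2
  have hcover : S ∩ B ⊆ ⋃ j, W j := by
    rintro w ⟨hwS, hwB⟩
    obtain ⟨z, hz, rfl⟩ := hbij.surjOn hwB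
    have hzV : z ∈ ⋃ j, V j := not_not.1 fun h => hc _ hwB hwS ⟨z, h, rfl⟩
    obtain ⟨j, hj⟩ := mem_iUnion.1 hzV
    exact mem_iUnion.2 ⟨j, z, ⟨hz, hj⟩, rfl⟩
  -- the part of a component outside the critical set lies in a single `W j`
  have hone : ∀ x j, ∀ w ∈ connectedComponentIn S x ∩ B, w ∈ W j →
      connectedComponentIn S x ∩ B ⊆ W j := by
    intro x j w hw hwj
    refine (isPreconnected_component_inter_lt hm hsum hμ hμc x).subset_left_of_subset_union
      (hWo j) (isOpen_iUnion fun l => isOpen_iUnion fun _ : l ≠ j => hWo l) ?_ ?_ ⟨w, hw, hwj⟩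
    · simp only [disjoint_iUnion_right]
      exact fun l hl => hWd j l hl.symm
    · intro v hv
      obtain ⟨l, hl⟩ := mem_iUnion.1 (hcover ⟨connectedComponentIn_subset S x hv.1, hv.2⟩)
      by_cases hlj : l = j
      · exact Or.inl (hlj ▸ hl)
      · exact Or.inr (mem_iUnion₂.2 ⟨l, hlj, hl⟩)
  -- Otherwise `A ∩ V j` would lie in the preimage of `{c ≤ lemMod}`, a closed subset of the plane
  -- contained in `A`; but a frontier point of `E j` is adherent to `A ∩ V j` and not in `A`.
  have hmeet : ∀ j, ∃ w ∈ W j, w ∈ S := by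
    intro j
    by_contra! hcon
    have hcl : IsClosed {w | c ≤ lemMod a m w} :=
      isClosed_le continuous_const (continuous_lemMod hm)
    have hsubB : {w | c ≤ lemMod a m w} ⊆ B := fun w hw => lt_of_lt_of_le hμc hw
    have hg := hf.symm
    have hclosed := hg.isClosed_image hcl hsubB
    have hsub : A ∩ V j ⊆ Function.invFunOn f A '' {w | c ≤ lemMod a m w} := fun z hz =>
      ⟨f z, show c ≤ lemMod a m (f z) from not_lt.1 (hcon _ ⟨z, hz, rfl⟩), hbij.injOn.leftInvOn_invFunOn hz.1⟩
    have himg : Function.invFunOn f A '' {w | c ≤ lemMod a m w} ⊆ A := by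
      rintro _ ⟨w, hw, rfl⟩
      exact hbij.surjOn.mapsTo_invFunOn (hsubB hw)
    have hfr : (frontier (E j)).Nonempty := by
      rw [nonempty_frontier_iff]
      refine ⟨hne j, fun h => ?_⟩
      have := hE j
      rw [h] at this
      exact noncompact_univ ℂ this
    obtain ⟨z, hz⟩ := hfr
    have hzE : z ∈ E j := (hE j).isClosed.frontier_subset hz
    have hzcl : z ∈ closure (A ∩ V j) := by
      rw [_root_.mem_closure_iff]
      intro o ho hzo
      have hz' : z ∈ closure (E j)ᶜ := by
        rw [frontier_eq_closure_inter_closure] at hz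
        exact hz.2
      obtain ⟨y, ⟨hyo, hyV⟩, hyE⟩ := _root_.mem_closure_iff.1 hz' _ (ho.inter (hVo j))
        ⟨hzo, hEV j hzE⟩
      refine ⟨y, hyo, ?_, hyV⟩
      simp only [hA, mem_compl_iff, mem_iUnion, not_exists]
      intro l hl
      by_cases hlj : l = j
      · exact hyE (hlj ▸ hl)
      · exact Set.disjoint_left.1 (hVd l j hlj) (hEV l hl) hyV
    have : z ∈ A := himg (closure_minimal hsub hclosed hzcl)
    exact this (mem_iUnion.2 ⟨j, hzE⟩)
  -- hence every `j` determines a focus, and this map is injective, so bijective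
  have hchoice : ∀ j, ∃ i, ∃ w, w ∈ connectedComponentIn S (a i) ∩ B ∧ w ∈ W j := by
    intro j
    obtain ⟨w, hwj, hwS⟩ := hmeet j
    obtain ⟨i, hi⟩ := exists_focus_mem_component hm hsum hwS
    refine ⟨i, w, ⟨?_, ?_⟩, hwj⟩
    · rw [← connectedComponentIn_eq hi]
      exact mem_connectedComponentIn hwS
    · obtain ⟨z, hz, rfl⟩ := hwj
      exact hbij.mapsTo hz.1
  choose σ w hw hwW using hchoice
  have hinj : ∀ i j, a (σ i) ∈ connectedComponentIn S (a (σ j)) → i = j := by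
    intro i j hij
    by_contra hne'
    have h1 := hw i
    rw [← connectedComponentIn_eq hij] at h1
    exact Set.disjoint_left.1 (hWd i j hne') (hwW i) (hone _ j _ (hw j) (hwW j) h1)
  have hself : ∀ i, a i ∈ connectedComponentIn S (a i) := fun i =>
    mem_connectedComponentIn (by
      rw [hS, mem_ofPred_eq, lemMod_focus hm]
      exact hμ.trans hμc)
  -- This is where the number of foci must equal the number of sets.
  have hσ : Function.Surjective σ := Finite.injective_iff_surjective.1 fun i j hij =>
    hinj i j (hij ▸ hself _)
  intro i l hil
  obtain ⟨i', rfl⟩ := hσ i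
  obtain ⟨l', rfl⟩ := hσ l
  rw [hinj l' i' hil]

/-! ### Logarithms of `w - b` off a compact set with connected complement -/

/-- The points `b` off `P` for which `w - b` has a logarithm on `U` form a nonempty (take `b` far
away), open and relatively closed subset of the connected set `Pᶜ`. Passing from `b₀` to a nearby
`b₁` costs only the principal logarithm of `(w - b₁) / (w - b₀)`. -/
theorem exists_log_sub_of_isPreconnected_compl {P U : Set ℂ} (hP : IsCompact P)
    (hPc : IsPreconnected Pᶜ) (hUP : U ⊆ P) {b : ℂ} (hb : b ∉ P) :
    ∃ l : ℂ → ℂ, DifferentiableOn ℂ l U ∧ ∀ w ∈ U, Complex.exp (l w) = w - b := by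
  set HasLog : ℂ → Prop := fun b =>
    ∃ l : ℂ → ℂ, DifferentiableOn ℂ l U ∧ ∀ w ∈ U, Complex.exp (l w) = w - b with hHasLog
  have step : ∀ b₀ b₁, HasLog b₀ → (∀ w ∈ P, ‖b₁ - b₀‖ < ‖w - b₀‖) → HasLog b₁ := by
    rintro b₀ b₁ ⟨l, hl, hle⟩ h
    have hne : ∀ w ∈ U, w - b₀ ≠ 0 := fun w hw =>
      norm_pos_iff.1 ((norm_nonneg _).trans_lt (h w (hUP hw)))
    have heq : ∀ w ∈ U, (w - b₁) / (w - b₀) = 1 + -((b₁ - b₀) / (w - b₀)) := fun w hw => by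
      field_simp [hne w hw]
      ring
    have hslit : ∀ w ∈ U, (w - b₁) / (w - b₀) ∈ Complex.slitPlane := fun w hw => by
      rw [heq w hw]
      refine Complex.mem_slitPlane_of_norm_lt_one ?_
      rw [norm_neg, norm_div, div_lt_one (norm_pos_iff.2 (hne w hw))]
      exact h w (hUP hw)
    refine ⟨fun w => l w + Complex.log ((w - b₁) / (w - b₀)), hl.add ?_, fun w hw => ?_⟩
    · exact DifferentiableOn.clog (((differentiableOn_id.sub_const _).div
        (differentiableOn_id.sub_const _)) hne) hslit
    · rw [Complex.exp_add, hle w hw, Complex.exp_log (Complex.slitPlane_ne_zero (hslit w hw)),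
        mul_div_cancel₀ _ (hne w hw)]
  have hball : ∀ b ∉ P, ∃ r > 0, ∀ b', ‖b' - b‖ < r → b' ∉ P := fun b hb => by
    obtain ⟨r, hr, h⟩ := Metric.isOpen_iff.1 hP.isClosed.isOpen_compl b hb
    exact ⟨r, hr, fun b' hb' => h (mem_ball_iff_norm.2 hb')⟩
  have hsub : Pᶜ ⊆ {b | b ∉ P ∧ HasLog b} := by
    refine hPc.subset_of_closure_inter_subset ?_ ?_ ?_
    · rw [Metric.isOpen_iff]
      rintro b₀ ⟨hb₀, hlog⟩
      obtain ⟨r, hr, h⟩ := hball b₀ hb₀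
      refine ⟨r, hr, fun b₁ hb₁ => ?_⟩
      rw [mem_ball_iff_norm] at hb₁
      exact ⟨h b₁ hb₁, step b₀ b₁ hlog fun w hw =>
        lt_of_lt_of_le hb₁ (not_lt.1 fun hlt => h w hlt hw)⟩
    · obtain ⟨R, hR⟩ := hP.isBounded.exists_norm_le
      obtain ⟨b, hbR⟩ := NormedSpace.exists_lt_norm ℂ ℂ (max R 0)
      have hbR1 : R < ‖b‖ := (le_max_left _ _).trans_lt hbR
      have hb0 : b ≠ 0 := norm_pos_iff.1 ((le_max_right _ _).trans_lt hbR)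
      have hbP : b ∉ P := fun h => (hR b h).not_gt hbR1
      have hslit : ∀ w ∈ U, 1 + -(w / b) ∈ Complex.slitPlane := fun w hw => by
        refine Complex.mem_slitPlane_of_norm_lt_one ?_
        rw [norm_neg, norm_div, div_lt_one (norm_pos_iff.2 hb0)]
        exact (hR w (hUP hw)).trans_lt hbR1
      refine ⟨b, hbP, hbP, fun w => Complex.log (1 + -(w / b)) + Complex.log (-b), ?_,
        fun w hw => ?_⟩
      · exact (DifferentiableOn.clog ((differentiableOn_const _).add
          (differentiableOn_id.div_const _).neg) hslit).add_const _
      · rw [Complex.exp_add, Complex.exp_log (Complex.slitPlane_ne_zero (hslit w hw)),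
          Complex.exp_log (neg_ne_zero.2 hb0)]
        field_simp
        ring
    · rintro b₁ ⟨hcl, hb₁⟩
      refine ⟨hb₁, ?_⟩
      obtain ⟨r, hr, h⟩ := hball b₁ hb₁
      obtain ⟨b₀, ⟨-, hlog⟩, hd⟩ := Metric.mem_closure_iff.1 hcl (r / 2) (by positivity)
      rw [dist_eq_norm] at hd
      refine step b₀ b₁ hlog fun w hw => ?_
      have h1 : r ≤ ‖w - b₁‖ := not_lt.1 fun hlt => h w hlt hw
      have h2 : ‖w - b₁‖ ≤ ‖w - b₀‖ + ‖b₁ - b₀‖ := by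
        calc ‖w - b₁‖ = ‖(w - b₀) - (b₁ - b₀)‖ := by ring_nf
          _ ≤ _ := norm_sub_le _ _
      linarith
  exact (hsub hb).2

/-! ### Proper holomorphic maps of degree one onto a disc -/

/-- By the identity theorem the points near which `u` is constantly `u w₀` form an open set which,
lying in a compact subset of `U`, is also closed in the plane. If nonempty, it would be all of the
noncompact plane. -/
theorem not_eventually_eq_of_isCompact {u : ℂ → ℂ} {U : Set ℂ} (hU : IsOpen U)
    (hu : DifferentiableOn ℂ u U) {w₀ : ℂ} (hw₀ : w₀ ∈ U)
    (hc : IsCompact {w ∈ U | u w = u w₀}) : ¬ ∀ᶠ z in 𝓝 w₀, u z = u w₀ := by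
  intro hev
  set O := {w | w ∈ U ∧ ∀ᶠ z in 𝓝 w, u z = u w₀} with hO
  have hOsub : O ⊆ {w ∈ U | u w = u w₀} := fun w hw => ⟨hw.1, hw.2.self_of_nhds⟩
  have hOo : IsOpen O := hU.inter isOpen_setOfPred_eventually_nhds
  have hOc : IsClosed O := by
    refine isClosed_of_closure_subset fun w hw => ?_
    have hwU : w ∈ U := (closure_minimal hOsub hc.isClosed hw).1
    refine ⟨hwU, ?_⟩
    have han : AnalyticAt ℂ u w := hu.analyticAt (hU.mem_nhds hwU)
    rcases (han.sub (analyticAt_const (v := u w₀))).eventually_eq_zero_or_eventually_ne_zero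
      with h | h
    · filter_upwards [h] with z hz using sub_eq_zero.1 hz
    · exfalso
      rw [eventually_nhdsWithin_iff] at h
      obtain ⟨V, hV, hVo, hwV⟩ := _root_.eventually_nhds_iff.1 h
      obtain ⟨y, hyV, hyO⟩ := _root_.mem_closure_iff.1 hw V hVo hwV
      have h2 : ∃ᶠ z in 𝓝[≠] y, z ∈ ({w}ᶜ : Set ℂ) := by
        by_cases hyw : y = w
        · subst hyw
          exact eventually_mem_nhdsWithin.frequently
        · exact (Eventually.filter_mono nhdsWithin_le_nhds
            (isOpen_compl_singleton.mem_nhds hyw)).frequently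
      refine h2 ?_
      filter_upwards [(hyO.2.and (hVo.mem_nhds hyV)).filter_mono nhdsWithin_le_nhds] with z hz hzw
      exact hV z hz.2 hzw (sub_eq_zero.2 hz.1)
  have huniv := IsClopen.eq_univ ⟨hOc, hOo⟩ ⟨w₀, hw₀, hev⟩
  have : IsCompact (univ : Set ℂ) := hc.of_isClosed_subset isClosed_univ (huniv ▸ hOsub)
  exact noncompact_univ ℂ this

/-- A continuity argument in place of degree theory: the values with exactly one preimage, which is
moreover noncritical, form an open and relatively closed subset of the disc containing `0`. -/
theorem bijOn_ball_of_proper {u : ℂ → ℂ} {U : Set ℂ} {R : ℝ} (hU : IsOpen U)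
    (hu : DifferentiableOn ℂ u U) (hmaps : MapsTo u U (ball 0 R))
    (hproper : ∀ r < R, IsCompact {w ∈ U | ‖u w‖ ≤ r}) {p : ℂ} (hp : p ∈ U) (hp0 : u p = 0)
    (hpd : deriv u p ≠ 0) (huniq : ∀ w ∈ U, u w = 0 → w = p) : BijOn u U (ball 0 R) := by
  have hcont := hu.continuousOn
  have han : ∀ w ∈ U, AnalyticAt ℂ u w := fun w hw => hu.analyticAt (hU.mem_nhds hw)
  have hnc : ∀ w ∈ U, ¬ ∀ᶠ z in 𝓝 w, u z = u w := by
    intro w hw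
    refine not_eventually_eq_of_isCompact hU hu hw ?_
    have hC := hproper ‖u w‖ (mem_ball_zero_iff.1 (hmaps hw))
    have : {z ∈ U | u z = u w} = {z ∈ U | ‖u z‖ ≤ ‖u w‖} ∩ u ⁻¹' {u w} := by
      ext z
      refine ⟨fun h => ⟨⟨h.1, ?_⟩, h.2⟩, fun h => ⟨h.1.1, h.2⟩⟩
      show ‖u z‖ ≤ ‖u w‖
      rw [h.2]
    rw [this]
    exact hC.of_isClosed_subset ((hcont.mono fun z hz => hz.1).preimage_isClosed_of_isClosed
      hC.isClosed isClosed_singleton) inter_subset_left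
  set S := {ζ | ζ ∈ ball (0 : ℂ) R ∧ ∃ w ∈ U, u w = ζ ∧ deriv u w ≠ 0 ∧ ∀ w' ∈ U, u w' = ζ → w' = w}
    with hS
  have hsub : ball (0 : ℂ) R ⊆ S := by
    refine (convex_ball (0 : ℂ) R).isPreconnected.subset_of_closure_inter_subset ?_ ?_ ?_
    · rw [isOpen_iff_mem_nhds]
      rintro _ ⟨hζ, w, hw, rfl, hd, hun⟩
      obtain ⟨r, hr1, hr2⟩ := exists_between (mem_ball_zero_iff.1 hζ)
      have hstrict := (han w hw).hasStrictDerivAt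
      obtain ⟨g, hg⟩ : ∃ g : ℂ → ℂ, ∀ᶠ x in 𝓝 w, g (u x) = x :=
        ⟨_, (hstrict.hasStrictFDerivAt_equiv hd).eventually_left_inverse⟩
      have hd' : ∀ᶠ z in 𝓝 w, deriv u z ≠ 0 :=
        (han w hw).deriv.continuousAt.eventually_ne hd
      obtain ⟨O, hO, hOo, hwO⟩ := _root_.eventually_nhds_iff.1
        ((hd'.and (hU.mem_nhds hw)).and hg)
      -- By properness the points outside `O` have compact image avoiding `u w`, so values near `u
      -- w` are taken only in `O`, where `u` has a left inverse.
      have hK : IsCompact ({z ∈ U | ‖u z‖ ≤ r} \ O) := (hproper r hr2).diff hOo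
      have hK' : IsCompact (u '' ({z ∈ U | ‖u z‖ ≤ r} \ O)) :=
        hK.image_of_continuousOn (hcont.mono fun z hz => hz.1.1)
      have h1 : (u '' ({z ∈ U | ‖u z‖ ≤ r} \ O))ᶜ ∈ 𝓝 (u w) := by
        refine hK'.isClosed.isOpen_compl.mem_nhds ?_
        rintro ⟨z, hz, e⟩
        rw [hun z hz.1.1 e] at hz
        exact hz.2 hwO
      have h2 : u '' O ∈ 𝓝 (u w) := by
        rw [← hstrict.map_nhds_eq hd]
        exact image_mem_map (hOo.mem_nhds hwO)
      have h3 : ball (0 : ℂ) r ∈ 𝓝 (u w) := isOpen_ball.mem_nhds (mem_ball_zero_iff.2 hr1)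
      filter_upwards [h1, h2, h3] with ζ hζ1 hζ2 hζ3
      obtain ⟨x, hxO, rfl⟩ := hζ2
      rw [mem_ball_zero_iff] at hζ3
      refine ⟨mem_ball_zero_iff.2 (hζ3.trans hr2), x, (hO x hxO).1.2, rfl,
        (hO x hxO).1.1,
        fun y hy hyx => ?_⟩
      have hyO : y ∈ O := by
        by_contra hyO
        exact hζ1 ⟨y, ⟨⟨hy, by rw [hyx]; exact hζ3.le⟩, hyO⟩, hyx⟩
      rw [← (hO y hyO).2, hyx, (hO x hxO).2]
    · have : (0 : ℂ) ∈ ball (0 : ℂ) R := hp0 ▸ hmaps hp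
      exact ⟨0, this, this, p, hp, hp0, hpd, huniq⟩
    · rintro ζ ⟨hcl, hζ⟩
      obtain ⟨r, hr1, hr2⟩ := exists_between (mem_ball_zero_iff.1 hζ)
      have hK := hproper r hr2
      have hK' : IsCompact (u '' {z ∈ U | ‖u z‖ ≤ r}) :=
        hK.image_of_continuousOn (hcont.mono fun z hz => hz.1)
      have hmeet : ∀ V ∈ 𝓝 ζ, ∃ ξ ∈ V, ξ ∈ S := fun V hV => mem_closure_iff_nhds.1 hcl V hV
      have hr3 : ball (0 : ℂ) r ∈ 𝓝 ζ := isOpen_ball.mem_nhds (mem_ball_zero_iff.2 hr1)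
      obtain ⟨w, hw, rfl⟩ : ζ ∈ u '' {z ∈ U | ‖u z‖ ≤ r} := by
        refine hK'.isClosed.closure_subset (mem_closure_iff_nhds.2 fun V hV => ?_)
        obtain ⟨ξ, hξV, -, w, hw, rfl, -⟩ := hmeet _ (inter_mem hV hr3)
        exact ⟨u w, hξV.1, w, ⟨hw, (mem_ball_zero_iff.1 hξV.2).le⟩, rfl⟩
      -- Two preimages of a limit value would, by the open mapping theorem, give two preimages of
      -- some value in `S`; a critical preimage is excluded below in the same way.
      have hun : ∀ w' ∈ U, u w' = u w → w' = w := by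
        intro w' hw' e
        by_contra hne
        obtain ⟨O', O, hO'o, hOo, hw'O', hwO, hdis⟩ := t2_separation hne
        have h1 : u '' (O' ∩ U) ∈ 𝓝 (u w) := e ▸
          nhds_le_map_nhds_of_not_eventually_eq (han w' hw') (hnc w' hw')
            (image_mem_map (inter_mem (hO'o.mem_nhds hw'O') (hU.mem_nhds hw')))
        have h2 : u '' (O ∩ U) ∈ 𝓝 (u w) :=
          nhds_le_map_nhds_of_not_eventually_eq (han w hw.1) (hnc w hw.1)
            (image_mem_map (inter_mem (hOo.mem_nhds hwO) (hU.mem_nhds hw.1)))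
        obtain ⟨ξ, ⟨⟨x, hx, hxξ⟩, ⟨y, hy, hyξ⟩⟩, -, v, -, -, -, hv⟩ := hmeet _ (inter_mem h1 h2)
        have hxy : x = y := (hv x hx.2 hxξ).trans (hv y hy.2 hyξ).symm
        exact Set.disjoint_left.1 hdis hx.1 (hxy ▸ hy.1)
      refine ⟨hζ, w, hw.1, rfl, fun hd => ?_, hun⟩
      have h2 := eventually_exists_two_preimages (han w hw.1) (hnc w hw.1) hd (hU.mem_nhds hw.1)
      obtain ⟨ξ, hξ, -, v, hvU, hvξ, hvd, hv⟩ := hmeet _ h2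
      have hξw : ξ ≠ u w := by
        rintro rfl
        rw [hun v hvU hvξ] at hvd
        exact hvd hd
      obtain ⟨x, hx, y, hy, hxy, e1, e2⟩ := hξ hξw
      exact hxy ((hv x hx e1).trans (hv y hy e2).symm)
  refine ⟨hmaps, fun x hx y hy hxy => ?_, fun ζ hζ => ?_⟩
  · obtain ⟨-, w, -, -, -, hw⟩ := hsub (hmaps hx)
    exact (hw x hx rfl).trans (hw y hy hxy.symm).symm
  · obtain ⟨-, w, hw, e, -⟩ := hsub hζ
    exact ⟨w, hw, e⟩

/-! ### The inner Riemann maps of a lemniscatic domain -/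

/-- The map is `(w - a i) * ∏_{j ≠ i} (w - a j) ^ (m j / m i)`. The other foci lie off the compact
set `N ∩ {lemMod ≤ c'}`, whose complement is connected, so the powers have holomorphic branches. The
formula for its modulus makes it proper, with `a i` as only zero. -/
theorem exists_inner_map (hm : ∀ j, 0 < m j) (hsum : ∑ j, m j = 1) {c c' : ℝ}
    (hc' : 0 < c') (hcc : c' < c) {i : Fin n}
    (hi : ∀ l, a l ∈ connectedComponentIn {w | lemMod a m w < c} (a i) → l = i) :
    ∃ u : ℂ → ℂ,
      DifferentiableOn ℂ u
        (connectedComponentIn {w | lemMod a m w < c} (a i) ∩ {w | lemMod a m w < c'}) ∧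
      (∀ w ∈ connectedComponentIn {w | lemMod a m w < c} (a i) ∩ {w | lemMod a m w < c'},
        ‖u w‖ = lemMod a m w ^ (m i)⁻¹) ∧
      BijOn u (connectedComponentIn {w | lemMod a m w < c} (a i) ∩ {w | lemMod a m w < c'})
        (ball 0 (c' ^ (m i)⁻¹)) := by
  set N := connectedComponentIn {w | lemMod a m w < c} (a i) with hN
  set U := N ∩ {w | lemMod a m w < c'} with hUdef
  have hmi := hm i
  have hUo : IsOpen U :=
    (isOpen_lemMod_lt hm c).connectedComponentIn.inter (isOpen_lemMod_lt hm c')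
  have hlog : ∀ j, j ≠ i → ∃ l : ℂ → ℂ, DifferentiableOn ℂ l U ∧
      ∀ w ∈ U, Complex.exp (l w) = w - a j := fun j hj =>
    exists_log_sub_of_isPreconnected_compl (isCompact_component_inter_le hm hsum hcc (a i))
      (isPreconnected_compl_component_inter_le hm hsum hc' hcc (a i))
      (fun w hw => ⟨hw.1, le_of_lt (show lemMod a m w < c' from hw.2)⟩)
      (fun h => hj (hi j h.1))
  choose! l hl hle using hlog
  set h : ℂ → ℂ := fun w => Complex.exp (((m i)⁻¹ : ℝ) *
    ∑ j ∈ Finset.univ.erase i, (m j : ℂ) * l j w) with hh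
  have hhd : DifferentiableOn ℂ h U := by
    refine ((DifferentiableOn.fun_sum fun j hj => ?_).const_mul _).cexp
    exact (hl j (Finset.ne_of_mem_erase hj)).const_mul _
  set u : ℂ → ℂ := fun w => (w - a i) * h w with hu
  have hud : DifferentiableOn ℂ u U := (differentiableOn_id.sub_const _).mul hhd
  have hnorm : ∀ w ∈ U, ‖u w‖ = lemMod a m w ^ (m i)⁻¹ := by
    intro w hw
    have h1 : ∀ j ∈ Finset.univ.erase i, ‖w - a j‖ ^ m j = Real.exp (m j * (l j w).re) := by
      intro j hj
      rw [← hle j (Finset.ne_of_mem_erase hj) w hw, Complex.norm_exp, ← Real.exp_mul, mul_comm]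
    rw [lemMod, ← Finset.mul_prod_erase _ _ (Finset.mem_univ i), Finset.prod_congr rfl h1,
      ← Real.exp_sum, Real.mul_rpow (Real.rpow_nonneg (norm_nonneg _) _) (Real.exp_pos _).le,
      Real.rpow_rpow_inv (norm_nonneg _) hmi.ne', ← Real.exp_mul, hu, norm_mul, hh,
      Complex.norm_exp, Complex.re_ofReal_mul, Complex.re_sum]
    simp only [Complex.re_ofReal_mul]
    rw [mul_comm (m i)⁻¹]
  refine ⟨u, hud, hnorm, ?_⟩
  have haN : a i ∈ N := mem_connectedComponentIn (by
    rw [mem_ofPred_eq, lemMod_focus hm]; exact hc'.trans hcc)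
  have haU : a i ∈ U := ⟨haN, by rw [mem_ofPred_eq, lemMod_focus hm]; exact hc'⟩
  refine bijOn_ball_of_proper hUo hud (fun w hw => ?_) (fun r hr => ?_) haU (by simp [hu]) ?_
    (fun w hw hw0 => ?_)
  · rw [mem_ball_zero_iff, hnorm w hw]
    exact Real.rpow_lt_rpow (lemMod_nonneg w) hw.2 (inv_pos.2 hmi)
  · rcases lt_or_ge r 0 with hr0 | hr0
    · convert isCompact_empty (X := ℂ)
      rw [eq_empty_iff_forall_notMem]
      intro w hw
      exact ((norm_nonneg _).trans (show ‖u w‖ ≤ r from hw.2)).not_gt hr0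
    · have hrc : r ^ m i < c' := by
        have := Real.rpow_lt_rpow hr0 hr hmi
        rwa [Real.rpow_inv_rpow hc'.le hmi.ne'] at this
      have heq : {w ∈ U | ‖u w‖ ≤ r} = N ∩ {w | lemMod a m w ≤ r ^ m i} := by
        ext w
        have key : w ∈ U → (‖u w‖ ≤ r ↔ lemMod a m w ≤ r ^ m i) := fun hw => by
          rw [hnorm w hw, Real.rpow_inv_le_iff_of_pos (lemMod_nonneg w) hr0 hmi]
        constructor
        · exact fun hw => ⟨hw.1.1, (key hw.1).1 hw.2⟩
        · intro hw
          have hwU : w ∈ U := ⟨hw.1, lt_of_le_of_lt (show lemMod a m w ≤ _ from hw.2) hrc⟩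
          exact ⟨hwU, (key hwU).2 hw.2⟩
      rw [heq]
      exact isCompact_component_inter_le hm hsum (hrc.trans hcc) (a i)
  · have h1 : HasDerivAt (fun z => z - a i) 1 (a i) := (hasDerivAt_id _).sub_const _
    have h2 := (h1.mul (hhd.differentiableAt (hUo.mem_nhds haU)).hasDerivAt).deriv
    have h3 : deriv u (a i) = h (a i) := by
      refine h2.trans ?_
      simp
    rw [h3]
    exact Complex.exp_ne_zero _
  · have h1 := hnorm w hw
    rw [hw0, norm_zero, eq_comm, Real.rpow_eq_zero (lemMod_nonneg w) (inv_pos.2 hmi).ne'] at h1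
    obtain ⟨j, rfl⟩ := (lemMod_eq_zero_iff hm).1 h1
    rw [hi j hw.1]

/-! ### Conformal maps between annuli -/

theorem annulus_eq_image_exp {r R : ℝ} (hr : 0 < r) :
    {ζ : ℂ | r < ‖ζ‖ ∧ ‖ζ‖ < R} = Complex.exp '' {s | Real.log r < s.re ∧ Real.exp s.re < R} := by
  ext ζ
  simp only [mem_ofPred_eq, mem_image]
  constructor
  · rintro ⟨h1, h2⟩
    have hpos := hr.trans h1
    refine ⟨Complex.log ζ, ?_, Complex.exp_log (norm_pos_iff.1 hpos)⟩
    rw [Complex.log_re, Real.exp_log hpos]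
    exact ⟨Real.log_lt_log hr h1, h2⟩
  · rintro ⟨s, ⟨h1, h2⟩, rfl⟩
    rw [Complex.norm_exp]
    exact ⟨(Real.log_lt_iff_lt_exp hr).1 h1, h2⟩

theorem isPreconnected_strip (r R : ℝ) :
    IsPreconnected {s : ℂ | Real.log r < s.re ∧ Real.exp s.re < R} := by
  rcases le_or_gt R 0 with hR | hR
  · convert isPreconnected_empty (α := ℂ)
    rw [eq_empty_iff_forall_notMem]
    exact fun s hs => ((Real.exp_pos s.re).trans_le (hs.2.le.trans hR)).false
  · refine Convex.isPreconnected ?_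
    have : {s : ℂ | Real.log r < s.re ∧ Real.exp s.re < R} =
        {s : ℂ | Real.log r < s.re} ∩ {s : ℂ | s.re < Real.log R} := by
      ext s
      simp only [mem_ofPred_eq, mem_inter_iff, Real.lt_log_iff_exp_lt hR]
    rw [this]
    exact (convex_halfSpace_re_gt _).inter (convex_halfSpace_re_lt _)

theorem isPreconnected_annulus {r R : ℝ} (hr : 0 < r) :
    IsPreconnected {ζ : ℂ | r < ‖ζ‖ ∧ ‖ζ‖ < R} := by
  rw [annulus_eq_image_exp hr]
  exact (isPreconnected_strip r R).image _ Complex.continuous_exp.continuousOn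

/-- Lifted to a strip, `S (exp s) * exp (-α s)` has modulus `1` and so is a constant `κ`.
Periodicity under `2πi` makes `α` an integer, and injectivity makes `1 / α` one. -/
theorem eq_const_mul_of_norm_eq_rpow {S : ℂ → ℂ} {r R α : ℝ} (hr : 0 < r) (hrR : r < R)
    (hα : 0 < α) (hS : DifferentiableOn ℂ S {ζ : ℂ | r < ‖ζ‖ ∧ ‖ζ‖ < R})
    (hinj : InjOn S {ζ : ℂ | r < ‖ζ‖ ∧ ‖ζ‖ < R})
    (hnorm : ∀ ζ : ℂ, r < ‖ζ‖ → ‖ζ‖ < R → ‖S ζ‖ = ‖ζ‖ ^ α) :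
    α = 1 ∧ ∃ κ : ℂ, ‖κ‖ = 1 ∧ ∀ ζ : ℂ, r < ‖ζ‖ → ‖ζ‖ < R → S ζ = κ * ζ := by
  set Strip := {s : ℂ | Real.log r < s.re ∧ Real.exp s.re < R} with hStrip
  have hexp : ∀ s ∈ Strip, Complex.exp s ∈ {ζ : ℂ | r < ‖ζ‖ ∧ ‖ζ‖ < R} := fun s hs => by
    rw [annulus_eq_image_exp hr]
    exact ⟨s, hs, rfl⟩
  have hStripo : IsOpen Strip := (isOpen_lt continuous_const Complex.continuous_re).inter
    (isOpen_lt (Real.continuous_exp.comp Complex.continuous_re) continuous_const)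
  set h : ℂ → ℂ := fun s => S (Complex.exp s) * Complex.exp (-(α * s)) with hh
  have hd : DifferentiableOn ℂ h Strip := by
    refine DifferentiableOn.mul (hS.comp Complex.differentiable_exp.differentiableOn hexp) ?_
    exact ((differentiableOn_id.const_mul _).neg).cexp
  have hn : ∀ s ∈ Strip, ‖h s‖ = 1 := fun s hs => by
    have h1 := hexp s hs
    rw [hh, norm_mul, hnorm _ h1.1 h1.2, Complex.norm_exp, Complex.norm_exp, ← Real.exp_mul,
      ← Real.exp_add, Complex.neg_re, Complex.re_ofReal_mul]
    ring_nf
    exact Real.exp_zero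
  obtain ⟨ρ, hρ1, hρ2⟩ := exists_between hrR
  have hρ0 := hr.trans hρ1
  have hmem : ∀ t : ℝ, ((Real.log ρ : ℝ) : ℂ) + t * Complex.I ∈ Strip := fun t => by
    simp only [hStrip, mem_ofPred_eq, Complex.add_re, Complex.ofReal_re, Complex.re_ofReal_mul,
      Complex.I_re, mul_zero, add_zero, Real.exp_log hρ0]
    exact ⟨Real.log_lt_log hr hρ1, hρ2⟩
  set s₀ : ℂ := ((Real.log ρ : ℝ) : ℂ) with hs₀
  have hs₀mem : s₀ ∈ Strip := by simpa using hmem 0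
  have hconst := Complex.eqOn_of_isPreconnected_of_isMaxOn_norm (isPreconnected_strip r R) hStripo hd
    hs₀mem (fun s hs => by
      simp only [Function.comp, mem_ofPred_eq]
      rw [hn s hs, hn s₀ hs₀mem])
  set κ := h s₀ with hκ
  have hκ1 : ‖κ‖ = 1 := hn s₀ hs₀mem
  have hκ0 : κ ≠ 0 := norm_pos_iff.1 (by rw [hκ1]; exact one_pos)
  have hSexp : ∀ s ∈ Strip, S (Complex.exp s) = κ * Complex.exp (α * s) := fun s hs => by
    have h1 : h s = κ := hconst hs
    rw [← h1, hh]
    simp only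
    rw [mul_assoc, ← Complex.exp_add, neg_add_cancel, Complex.exp_zero, mul_one]
  have hpi : (2 * Real.pi * Complex.I : ℂ) ≠ 0 := Complex.two_pi_I_ne_zero
  obtain ⟨k, hk⟩ : ∃ k : ℤ, α = k := by
    have h1 := hSexp _ (hmem (2 * Real.pi))
    have h2 := hSexp _ hs₀mem
    have h3 : Complex.exp (s₀ + ((2 * Real.pi : ℝ) : ℂ) * Complex.I) = Complex.exp s₀ := by
      push_cast
      exact Complex.exp_periodic s₀
    rw [h3, h2, mul_add, Complex.exp_add] at h1
    have h4 := mul_left_cancel₀ hκ0 h1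
    have h5 : Complex.exp (α * (((2 * Real.pi : ℝ) : ℂ) * Complex.I)) = 1 :=
      (mul_left_cancel₀ (Complex.exp_ne_zero _) ((mul_one _).trans h4)).symm
    obtain ⟨k, hk⟩ := Complex.exp_eq_one_iff.1 h5
    refine ⟨k, ?_⟩
    push_cast at hk
    exact_mod_cast mul_right_cancel₀ hpi hk
  -- Shifting `s₀` by `2πi / α` does not change `κ * exp (α s)`, so by injectivity of `S` it does
  -- not change `exp s` either.
  obtain ⟨l, hl⟩ : ∃ l : ℤ, 1 / α = l := by
    have h1 := hSexp _ (hmem (2 * Real.pi / α))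
    have h2 := hSexp _ hs₀mem
    have hα' : (α : ℂ) ≠ 0 := Complex.ofReal_ne_zero.2 hα.ne'
    have h3 : (α : ℂ) * (s₀ + ((2 * Real.pi / α : ℝ) : ℂ) * Complex.I) =
        α * s₀ + 2 * Real.pi * Complex.I := by
      push_cast
      field_simp
    rw [h3, Complex.exp_periodic, ← h2] at h1
    have h4 := hinj (hexp _ (hmem _)) (hexp _ hs₀mem) h1
    rw [Complex.exp_add] at h4
    have h5 := mul_left_cancel₀ (Complex.exp_ne_zero _) (h4.trans (mul_one _).symm)
    obtain ⟨l, hl⟩ := Complex.exp_eq_one_iff.1 h5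
    refine ⟨l, ?_⟩
    have h6 : ((1 / α : ℝ) : ℂ) * (2 * Real.pi * Complex.I) = l * (2 * Real.pi * Complex.I) := by
      rw [← hl]
      push_cast
      ring
    exact_mod_cast mul_right_cancel₀ hpi h6
  have hα1 : α = 1 := by
    have hkl : (k : ℝ) * l = 1 := by rw [← hk, ← hl, mul_one_div_cancel hα.ne']
    have hkl' : k * l = 1 := by exact_mod_cast hkl
    have hk0 : 0 ≤ k := by
      have : (0 : ℝ) ≤ k := hk ▸ hα.le
      exact_mod_cast this
    rw [hk, Int.eq_one_of_mul_eq_one_right hk0 hkl', Int.cast_one]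
  refine ⟨hα1, κ, hκ1, fun ζ h1 h2 => ?_⟩
  have : ζ ∈ Complex.exp '' Strip := by
    rw [← annulus_eq_image_exp hr]
    exact ⟨h1, h2⟩
  obtain ⟨s, hs, rfl⟩ := this
  rw [hSexp s hs, hα1, Complex.ofReal_one, one_mul]

/-! ### Normalized conformal maps preserve the Green function -/

variable {n' : ℕ} {b : Fin n' → ℂ} {k : Fin n' → ℝ}

/-- Because the exponents sum to `1`, all these functions have the same logarithmic pole at
infinity, which cancels in differences. -/
theorem tendsto_log_lemMod_sub_log_norm (hm : ∀ j, 0 < m j) (hsum : ∑ j, m j = 1) {f : ℂ → ℂ}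
    (hf : Tendsto (fun z => f z - z) (cobounded ℂ) (𝓝 0)) :
    Tendsto (fun w => Real.log (lemMod a m (f w)) - Real.log ‖w‖) (cobounded ℂ) (𝓝 0) := by
  have hterm : ∀ j, Tendsto (fun w => ‖f w - a j‖ / ‖w‖) (cobounded ℂ) (𝓝 1) := fun j => by
    have h1 : Tendsto (fun w : ℂ => (f w - w - a j) * w⁻¹) (cobounded ℂ) (𝓝 ((0 - a j) * 0)) :=
      (hf.sub_const (a j)).mul tendsto_inv₀_cobounded
    rw [mul_zero] at h1
    have h2 := (h1.const_add 1).norm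
    rw [add_zero, norm_one] at h2
    refine h2.congr' ?_
    filter_upwards [eventually_ne_cobounded (0 : ℂ)] with w hw
    rw [← norm_div]
    congr 1
    field_simp
    ring
  have h3 : Tendsto (fun w => ∑ j, m j * Real.log (‖f w - a j‖ / ‖w‖)) (cobounded ℂ)
      (𝓝 (∑ j, m j * Real.log 1)) :=
    tendsto_finsetSum _ fun j _ => ((hterm j).log one_ne_zero).const_mul _
  simp only [Real.log_one, mul_zero, Finset.sum_const_zero] at h3
  refine h3.congr' ?_
  have hpos := ((tendsto_lemMod (a := a) hm hsum).comp
    (NormalizedConformal.tendsto_cobounded_of_sub hf)).eventually_gt_atTop 0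
  filter_upwards [hpos, eventually_ne_cobounded (0 : ℂ)] with w hw hw0
  have hne : lemMod a m (f w) ≠ 0 := ne_of_gt hw
  rw [log_lemMod hm hne]
  have h4 : ∀ j, ‖f w - a j‖ ≠ 0 := fun j h => hne ((lemMod_eq_zero_iff hm).2
    ⟨j, sub_eq_zero.1 (norm_eq_zero.1 h)⟩)
  simp_rw [Real.log_div (h4 _) (norm_ne_zero_iff.2 hw0), mul_sub, Finset.sum_sub_distrib,
    ← Finset.sum_mul, hsum, one_mul]

/-- The harmonic difference `G` tends to `0` at infinity, and its superlevel sets stay away from the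
boundary: where `ε ≤ G`, the image point has modulus at least `μ * exp ε`. Equality follows by
applying this to the inverse of `T` too. -/
theorem lemMod_map_le (hm : ∀ j, 0 < m j) (hsum : ∑ j, m j = 1) (hk : ∀ j, 0 < k j)
    (hksum : ∑ j, k j = 1) {μ : ℝ} (hμ : 0 < μ) {T : ℂ → ℂ}
    (hT : NormalizedConformal T {w | μ < lemMod a m w} {w | μ < lemMod b k w}) {w : ℂ}
    (hw : μ < lemMod a m w) : lemMod b k (T w) ≤ lemMod a m w := by
  set G : ℂ → ℝ := fun w => Real.log (lemMod b k (T w)) - Real.log (lemMod a m w) with hG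
  have hmaps : ∀ w, μ < lemMod a m w → μ < lemMod b k (T w) := fun w hw => hT.bijOn.mapsTo hw
  have hharm : HarmonicOnNhd G {w | μ < lemMod a m w} := fun z hz =>
    (harmonicAt_log_lemMod_comp hk (hT.differentiableOn.analyticAt (hT.isOpen.mem_nhds hz))
      (hμ.trans (hmaps z hz)).ne').sub
    (harmonicAt_log_lemMod_comp hm analyticAt_id (hμ.trans (show μ < lemMod a m z from hz)).ne')
  have hlim : Tendsto G (cobounded ℂ) (𝓝 0) := by
    have h := (tendsto_log_lemMod_sub_log_norm (a := b) hk hksum hT.tendsto_sub).sub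
      (tendsto_log_lemMod_sub_log_norm (a := a) hm hsum (f := id)
        (by simp))
    rw [sub_zero] at h
    exact h.congr fun w => by simp [hG]
  have hle : G w ≤ 0 := by
    refine harmonic_nonpos_of_isCompact hT.isOpen hharm (fun ε hε => ?_) hw
    set C := {v | μ * Real.exp ε ≤ lemMod b k v} with hC
    have hCsub : C ⊆ {w | μ < lemMod b k w} := fun v hv =>
      lt_of_lt_of_le (lt_mul_of_one_lt_right hμ (Real.one_lt_exp_iff.2 hε)) hv
    have hCcl : IsClosed C := isClosed_le continuous_const (continuous_lemMod hk)
    set Q := Function.invFunOn T {w | μ < lemMod a m w} '' C with hQ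
    have hQcl : IsClosed Q := hT.symm.isClosed_image hCcl hCsub
    have hQsub : Q ⊆ {w | μ < lemMod a m w} := by
      rintro _ ⟨v, hv, rfl⟩
      exact hT.symm.bijOn.mapsTo (hCsub hv)
    have heq : {w ∈ {w | μ < lemMod a m w} | ε ≤ G w} = Q ∩ G ⁻¹' Ici ε := by
      ext x
      refine ⟨fun hx => ⟨⟨T x, ?_, hT.bijOn.injOn.leftInvOn_invFunOn hx.1⟩, hx.2⟩,
        fun hx => ⟨hQsub hx.1, hx.2⟩⟩
      have h1 : μ < lemMod a m x := hx.1
      have h2 : ε ≤ Real.log (lemMod b k (T x)) - Real.log (lemMod a m x) := hx.2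
      have h3 := Real.log_lt_log hμ h1
      have h4 : Real.log (μ * Real.exp ε) ≤ Real.log (lemMod b k (T x)) := by
        rw [Real.log_mul hμ.ne' (Real.exp_pos _).ne', Real.log_exp]
        linarith
      exact (Real.log_le_log_iff (by positivity) (hμ.trans (hmaps x h1))).1 h4
    refine isCompact_of_isClosed_isBounded ?_ ?_
    · rw [heq]
      exact (hharm.contDiffOn.continuousOn.mono hQsub).preimage_isClosed_of_isClosed hQcl
        isClosed_Ici
    · rw [← isCobounded_compl_iff, isCobounded_def]
      filter_upwards [hlim.eventually (gt_mem_nhds hε)] with x hx hx'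
      exact hx.not_ge hx'.2
  have h1 := hμ.trans hw
  have h2 := hμ.trans (hmaps w hw)
  exact (Real.log_le_log_iff h2 h1).1 (sub_nonpos.1 hle)

theorem lemMod_map_eq (hm : ∀ j, 0 < m j) (hsum : ∑ j, m j = 1) (hk : ∀ j, 0 < k j)
    (hksum : ∑ j, k j = 1) {μ : ℝ} (hμ : 0 < μ) {T : ℂ → ℂ}
    (hT : NormalizedConformal T {w | μ < lemMod a m w} {w | μ < lemMod b k w}) {w : ℂ}
    (hw : μ < lemMod a m w) : lemMod b k (T w) = lemMod a m w := by
  refine (lemMod_map_le hm hsum hk hksum hμ hT hw).antisymm ?_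
  have h := lemMod_map_le hk hksum hm hsum hμ hT.symm (hT.bijOn.mapsTo hw)
  rwa [hT.bijOn.injOn.leftInvOn_invFunOn hw] at h

/-! ### Normalized conformal maps between lemniscatic domains are the identity -/

/-- In the inner coordinates `u` and `v`, `T` becomes an annulus map with `‖S ζ‖ = ‖ζ‖ ^ (m i / k
j)`, hence multiplication by some unimodular `κ`. The extension is `v⁻¹ (κ * u w)`. -/
theorem exists_extension_across_component (hm : ∀ j, 0 < m j) (hsum : ∑ j, m j = 1)
    (hk : ∀ j, 0 < k j) (hksum : ∑ j, k j = 1) {μ c c' : ℝ} (hμ : 0 < μ) (hμc' : μ < c')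
    (hcc : c' < c) {T : ℂ → ℂ}
    (hT : NormalizedConformal T {w | μ < lemMod a m w} {w | μ < lemMod b k w}) {i : Fin n}
    (hi : ∀ l, a l ∈ connectedComponentIn {w | lemMod a m w < c} (a i) → l = i)
    (hb : ∀ i l, b l ∈ connectedComponentIn {w | lemMod b k w < c} (b i) → l = i) :
    ∃ H : ℂ → ℂ,
      DifferentiableOn ℂ H
        (connectedComponentIn {w | lemMod a m w < c} (a i) ∩ {w | lemMod a m w < c'}) ∧
      ∀ w ∈ connectedComponentIn {w | lemMod a m w < c} (a i) ∩ {w | lemMod a m w < c'},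
        μ < lemMod a m w → H w = T w := by
  have hc' : 0 < c' := hμ.trans hμc'
  obtain ⟨u, hud, hun, hub⟩ := exists_inner_map hm hsum hc' hcc hi
  set U := connectedComponentIn {w | lemMod a m w < c} (a i) ∩ {w | lemMod a m w < c'} with hU
  have hUo : IsOpen U :=
    (isOpen_lemMod_lt hm c).connectedComponentIn.inter (isOpen_lemMod_lt hm c')
  have hmi := hm i
  have hmi' := inv_pos.2 hmi
  set r := μ ^ (m i)⁻¹ with hr
  set R := c' ^ (m i)⁻¹ with hR
  have hr0 : 0 < r := Real.rpow_pos_of_pos hμ _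
  have hrR : r < R := Real.rpow_lt_rpow hμ.le hμc' hmi'
  set g := Function.invFunOn u U with hg
  have hginv : InvOn g u U (ball 0 R) := hub.invOn_invFunOn
  have hgmaps : MapsTo g (ball 0 R) U := hub.surjOn.mapsTo_invFunOn
  have hgd : DifferentiableOn ℂ g (ball 0 R) := by
    rw [← hub.image_eq]
    exact (image_open_and_differentiableOn_leftInv hUo hud hub.injOn hginv.1).2
  set Ann := {ζ : ℂ | r < ‖ζ‖ ∧ ‖ζ‖ < R} with hAnn
  have hAnnBall : Ann ⊆ ball 0 R := fun ζ hζ => mem_ball_zero_iff.2 hζ.2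
  have hnormg : ∀ ζ ∈ Ann, lemMod a m (g ζ) ^ (m i)⁻¹ = ‖ζ‖ := fun ζ hζ => by
    rw [← hun _ (hgmaps (hAnnBall hζ)), hginv.2 (hAnnBall hζ)]
  have hgL : ∀ ζ ∈ Ann, μ < lemMod a m (g ζ) := fun ζ hζ => by
    have h1 := hζ.1
    rw [← hnormg ζ hζ] at h1
    exact (Real.rpow_lt_rpow_iff hμ.le (lemMod_nonneg _) hmi').1 h1
  have huAnn : ∀ w ∈ U, μ < lemMod a m w → u w ∈ Ann := fun w hw hwμ => by
    refine ⟨?_, mem_ball_zero_iff.1 (hub.mapsTo hw)⟩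
    rw [hun w hw]
    exact Real.rpow_lt_rpow hμ.le hwμ hmi'
  have hTval : ∀ ζ ∈ Ann, lemMod b k (T (g ζ)) = lemMod a m (g ζ) := fun ζ hζ =>
    lemMod_map_eq hm hsum hk hksum hμ hT (hgL ζ hζ)
  have hTgd : DifferentiableOn ℂ (fun ζ => T (g ζ)) Ann :=
    hT.differentiableOn.comp (hgd.mono hAnnBall) hgL
  have hTglt : ∀ ζ ∈ Ann, lemMod b k (T (g ζ)) < c' := fun ζ hζ => by
    rw [hTval ζ hζ]
    exact (hgmaps (hAnnBall hζ)).2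
  -- the image of the annulus lies in one component
  obtain ⟨ρ, hρ1, hρ2⟩ := exists_between hrR
  have hρ : (ρ : ℂ) ∈ Ann := by
    simp only [hAnn, mem_ofPred_eq, Complex.norm_real, Real.norm_eq_abs,
      abs_of_pos (hr0.trans hρ1)]
    exact ⟨hρ1, hρ2⟩
  obtain ⟨j, hj⟩ := exists_focus_mem_component hk hksum ((hTglt _ hρ).trans hcc)
  have hcomp : ∀ ζ ∈ Ann, T (g ζ) ∈ connectedComponentIn {w | lemMod b k w < c} (b j) := by
    intro ζ hζ
    rw [← connectedComponentIn_eq hj]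
    refine ((isPreconnected_annulus hr0).image _ hTgd.continuousOn).subset_connectedComponentIn
      (mem_image_of_mem _ hρ) ?_ (mem_image_of_mem (fun ζ => T (g ζ)) hζ)
    rintro _ ⟨ξ, hξ, rfl⟩
    exact (hTglt ξ hξ).trans hcc
  obtain ⟨v, hvd, hvn, hvb⟩ := exists_inner_map hk hksum hc' hcc (hb j)
  set V := connectedComponentIn {w | lemMod b k w < c} (b j) ∩ {w | lemMod b k w < c'} with hV
  have hVo : IsOpen V :=
    (isOpen_lemMod_lt hk c).connectedComponentIn.inter (isOpen_lemMod_lt hk c')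
  have hTgV : MapsTo (fun ζ => T (g ζ)) Ann V := fun ζ hζ => ⟨hcomp ζ hζ, hTglt ζ hζ⟩
  have hkj := hk j
  obtain ⟨hα, κ, hκ1, hκ⟩ := eq_const_mul_of_norm_eq_rpow (S := fun ζ => v (T (g ζ)))
    (α := m i * (k j)⁻¹) hr0 hrR (mul_pos hmi (inv_pos.2 hkj)) (hvd.comp hTgd hTgV)
    (fun ζ hζ ξ hξ e => by
      have h1 := hT.bijOn.injOn (hgL ζ hζ) (hgL ξ hξ) (hvb.injOn (hTgV hζ) (hTgV hξ) e)
      rw [← hginv.2 (hAnnBall hζ), ← hginv.2 (hAnnBall hξ), h1])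
    (fun ζ h1 h2 => by
      have hζ : ζ ∈ Ann := ⟨h1, h2⟩
      rw [hvn _ (hTgV hζ), hTval ζ hζ, ← hnormg ζ hζ, ← Real.rpow_mul (lemMod_nonneg _),
        inv_mul_cancel_left₀ hmi.ne'])
  -- Equal exponents give equal disc radii, so `κ * u w` lies in the image of `v`.
  have hmk : (k j)⁻¹ = (m i)⁻¹ := eq_inv_of_mul_eq_one_right hα
  rw [hmk] at hvb
  set h := Function.invFunOn v V with hh
  have hhinv : InvOn h v V (ball 0 R) := hvb.invOn_invFunOn
  have hhd : DifferentiableOn ℂ h (ball 0 R) := by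
    rw [← hvb.image_eq]
    exact (image_open_and_differentiableOn_leftInv hVo hvd hvb.injOn hhinv.1).2
  refine ⟨fun w => h (κ * u w), hhd.comp (hud.const_mul κ) fun w hw => ?_, fun w hw hwμ => ?_⟩
  · rw [mem_ball_zero_iff, norm_mul, hκ1, one_mul]
    exact mem_ball_zero_iff.1 (hub.mapsTo hw)
  · have hζ := huAnn w hw hwμ
    have h1 := hκ _ hζ.1 hζ.2
    have h2 := hTgV hζ
    simp only at h2
    rw [hginv.1 hw] at h1 h2
    show h (κ * u w) = T w
    rw [← h1, hhinv.1 h2]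

theorem normalizedConformal_lemniscatic_eq_id (hm : ∀ j, 0 < m j) (hsum : ∑ j, m j = 1)
    (hk : ∀ j, 0 < k j) (hksum : ∑ j, k j = 1) {μ c : ℝ} (hμ : 0 < μ) (hμc : μ < c) {T : ℂ → ℂ}
    (hT : NormalizedConformal T {w | μ < lemMod a m w} {w | μ < lemMod b k w})
    (ha : ∀ i l, a l ∈ connectedComponentIn {w | lemMod a m w < c} (a i) → l = i)
    (hb : ∀ i l, b l ∈ connectedComponentIn {w | lemMod b k w < c} (b i) → l = i) {w : ℂ}
    (hw : μ < lemMod a m w) : T w = w := by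
  obtain ⟨c', hμc', hcc⟩ := exists_between hμc
  choose H hHd hHT using fun i => exists_extension_across_component hm hsum hk hksum hμ hμc' hcc hT
    (ha i) hb
  set S := {w | lemMod a m w < c} with hS
  set U : Fin n → Set ℂ := fun i => connectedComponentIn S (a i) ∩ {w | lemMod a m w < c'} with hU
  have hUo : ∀ i, IsOpen (U i) := fun i =>
    (isOpen_lemMod_lt hm c).connectedComponentIn.inter (isOpen_lemMod_lt hm c')
  have haS : ∀ i, a i ∈ S := fun i => by
    rw [hS, mem_ofPred_eq, lemMod_focus hm]; exact hμ.trans hμc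
  have hUdisj : ∀ i l z, z ∈ U i → z ∈ U l → l = i := fun i l z hi hl => by
    refine ha i l ?_
    rw [connectedComponentIn_eq hi.1, ← connectedComponentIn_eq hl.1]
    exact mem_connectedComponentIn (haS l)
  have hcover : ∀ z, ¬ μ < lemMod a m z → ∃ i, z ∈ U i := fun z hz => by
    have hzS : z ∈ S := (not_lt.1 hz).trans_lt hμc
    obtain ⟨i, hi⟩ := exists_focus_mem_component hm hsum hzS
    refine ⟨i, ?_, (not_lt.1 hz).trans_lt hμc'⟩
    rw [← connectedComponentIn_eq hi]
    exact mem_connectedComponentIn hzS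
  classical
  -- The choice of component is immaterial: distinct foci have disjoint `U i`, so `F` agrees with `H
  -- i` on all of `U i`.
  set F : ℂ → ℂ := fun z => if h : μ < lemMod a m z then T z else H (hcover z h).choose z with hF
  have hFT : ∀ z, μ < lemMod a m z → F z = T z := fun z hz => dif_pos hz
  have hFH : ∀ i, ∀ z ∈ U i, F z = H i z := fun i z hz => by
    by_cases h : μ < lemMod a m z
    · rw [hFT z h, hHT i z hz h]
    · have h1 := hUdisj i _ z hz (hcover z h).choose_spec
      simp only [hF, dif_neg h]
      rw [h1]
  have hFd : Differentiable ℂ F := fun z => by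
    by_cases h : μ < lemMod a m z
    · refine ((hT.differentiableOn.differentiableAt (hT.isOpen.mem_nhds h))).congr_of_eventuallyEq ?_
      filter_upwards [hT.isOpen.mem_nhds h] with y hy using hFT y hy
    · obtain ⟨i, hi⟩ := hcover z h
      refine ((hHd i).differentiableAt ((hUo i).mem_nhds hi)).congr_of_eventuallyEq ?_
      filter_upwards [(hUo i).mem_nhds hi] with y hy using hFH i y hy
  have hlim : Tendsto (fun z => F z - z) (cocompact ℂ) (𝓝 0) := by
    rw [← Metric.cobounded_eq_cocompact]
    refine hT.tendsto_sub.congr' ?_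
    filter_upwards [hT.mem_cobounded] with z hz
    rw [hFT z hz]
  have h := (hFd.sub differentiable_id).apply_eq_of_tendsto_cocompact w hlim
  rw [← hFT w hw]
  exact sub_eq_zero.1 h

/-- Uniqueness of the lemniscatic map, for lemniscatic domains of equal level. -/
theorem eqOn_of_normalizedConformal {n : ℕ} {a b : Fin n → ℂ} {m k : Fin n → ℝ}
    (hm : ∀ j, 0 < m j) (hsum : ∑ j, m j = 1) (hk : ∀ j, 0 < k j) (hksum : ∑ j, k j = 1) {μ : ℝ}
    (hμ : 0 < μ) {E : Fin n → Set ℂ} (hE : ∀ j, IsCompact (E j)) (hne : ∀ j, (E j).Nonempty)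
    (hdisj : ∀ i j, i ≠ j → Disjoint (E i) (E j)) {f g : ℂ → ℂ}
    (hf : NormalizedConformal f (⋃ j, E j)ᶜ {w | μ < lemMod a m w})
    (hg : NormalizedConformal g (⋃ j, E j)ᶜ {w | μ < lemMod b k w}) :
    EqOn f g (⋃ j, E j)ᶜ := by
  obtain ⟨c₁, hc₁, ha⟩ := exists_level_isolating_foci hm hsum hμ hE hne hdisj hf
  obtain ⟨c₂, hc₂, hb⟩ := exists_level_isolating_foci hk hksum hμ hE hne hdisj hg
  intro z hz
  -- The isolating property passes to any smaller level, because components shrink with it.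
  have h := normalizedConformal_lemniscatic_eq_id hm hsum hk hksum hμ (lt_min hc₁ hc₂)
    (hg.comp hf.symm)
    (fun i l h => ha i l (connectedComponentIn_mono _
      (fun w hw => lt_of_lt_of_le (show lemMod a m w < _ from hw) (min_le_left _ _)) h))
    (fun i l h => hb i l (connectedComponentIn_mono _
      (fun w hw => lt_of_lt_of_le (show lemMod b k w < _ from hw) (min_le_right _ _)) h))
    (hf.bijOn.mapsTo hz)
  simp only [Function.comp] at h
  rw [hf.bijOn.injOn.leftInvOn_invFunOn hz] at h
  exact h.symm

/-! ### From the sphere to the plane -/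

theorem coe_toComplex {p : Sphere} (hp : p ≠ OnePoint.infty) : ((toComplex p : ℂ) : Sphere) = p := by
  induction p using OnePoint.rec with
  | infty => exact absurd rfl hp
  | coe z => rfl

section

variable {E : Fin n → Set ℂ} {μ : ℝ}

theorem coe_mem_exteriorDomain {z : ℂ} : (z : Sphere) ∈ exteriorDomain E ↔ z ∈ (⋃ j, E j)ᶜ := by
  rw [exteriorDomain, mem_compl_iff, mem_compl_iff, not_iff_not]
  exact OnePoint.coe_injective.mem_set_image

theorem infty_mem_exteriorDomain : (OnePoint.infty : Sphere) ∈ exteriorDomain E := by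
  rintro ⟨z, -, hz⟩
  exact OnePoint.coe_ne_infty z hz

theorem coe_mem_lemniscaticSet {w : ℂ} : (w : Sphere) ∈ lemniscaticSet a m μ ↔ μ < lemMod a m w := by
  rw [lemniscaticSet, mem_insert_iff, OnePoint.coe_injective.mem_set_image]
  exact or_iff_right (OnePoint.coe_ne_infty w)

variable {L : Set Sphere} {Φ : Sphere → Sphere}

theorem IsLemniscaticMap.coe_toComplex_apply (hΦ : IsLemniscaticMap E L Φ) {z : ℂ}
    (hz : z ∈ (⋃ j, E j)ᶜ) : ((toComplex (Φ z) : ℂ) : Sphere) = Φ z := by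
  refine coe_toComplex fun h => ?_
  have := hΦ.conformal.1.injOn (coe_mem_exteriorDomain.2 hz) infty_mem_exteriorDomain
    (h.trans hΦ.normalized.1.symm)
  exact OnePoint.coe_ne_infty z this

theorem IsLemniscaticMap.normalizedConformal (hΦ : IsLemniscaticMap E (lemniscaticSet a m μ) Φ)
    (hE : ∀ j, IsCompact (E j)) :
    NormalizedConformal (fun z : ℂ => toComplex (Φ z)) (⋃ j, E j)ᶜ {w | μ < lemMod a m w} := by
  have hcoe : ∀ {z : ℂ}, z ∈ (⋃ j, E j)ᶜ → ((toComplex (Φ z) : ℂ) : Sphere) = Φ z := fun hz =>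
    hΦ.coe_toComplex_apply hz
  have hcpt : IsCompact (⋃ j, E j) := isCompact_iUnion hE
  obtain ⟨⟨hmaps, hinj, hsurj⟩, hdiff⟩ := hΦ.conformal
  refine ⟨hcpt.isClosed.isOpen_compl, isCobounded_def.1 (isCobounded_compl_iff.2 hcpt.isBounded),
    ⟨fun z hz => ?_, fun z hz z' hz' e => ?_, fun w hw => ?_⟩, fun z hz => ?_, ?_⟩
  · have h := hmaps (coe_mem_exteriorDomain.2 hz)
    rw [← hcoe hz] at h
    exact coe_mem_lemniscaticSet.1 h
  · have h : Φ z = Φ z' := by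
      rw [← hcoe hz, ← hcoe hz']
      exact congrArg _ e
    exact OnePoint.coe_injective
      (hinj (coe_mem_exteriorDomain.2 hz) (coe_mem_exteriorDomain.2 hz') h)
  · obtain ⟨p, hp, hpw⟩ := hsurj (coe_mem_lemniscaticSet.2 hw)
    have hp' : p ≠ OnePoint.infty := by
      rintro rfl
      rw [hΦ.normalized.1] at hpw
      exact OnePoint.infty_ne_coe w hpw
    rw [← coe_toComplex hp'] at hp hpw
    refine ⟨toComplex p, coe_mem_exteriorDomain.1 hp, ?_⟩
    simp only [hpw]
    rfl
  · have h := (hdiff z (coe_mem_exteriorDomain.2 hz)).2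
    have h1 : Φ z ≠ OnePoint.infty := hcoe hz ▸ OnePoint.coe_ne_infty _
    simp only [localCoord, localParam, if_neg h1, if_neg (OnePoint.coe_ne_infty z)] at h
    exact DifferentiableAt.differentiableWithinAt h
  -- Of the normalization at infinity, only the vanishing of the error is kept.
  · exact hΦ.normalized.2.trans_tendsto tendsto_inv₀_cobounded

/-! ### Symmetries -/

theorem lemMod_comp_isometry {σ τ : ℂ → ℂ} (hστ : ∀ z, σ (τ z) = z)
    (hiso : ∀ x y, ‖σ x - σ y‖ = ‖x - y‖) (w : ℂ) :
    lemMod (fun j => τ (a j)) m w = lemMod a m (σ w) := by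
  refine Finset.prod_congr rfl fun j _ => ?_
  rw [← hiso, hστ]

/-- The hypothesis `hd` covers both holomorphic and antiholomorphic isometries: conjugating on both
sides restores holomorphy. -/
theorem NormalizedConformal.conj_isometry {f : ℂ → ℂ} {A : Set ℂ} {σ τ : ℂ → ℂ}
    (hf : NormalizedConformal f A {w | μ < lemMod a m w}) (hτσ : ∀ z, τ (σ z) = z)
    (hστ : ∀ z, σ (τ z) = z) (hiso : ∀ x y, ‖σ x - σ y‖ = ‖x - y‖)
    (hd : ∀ (f : ℂ → ℂ) (z : ℂ), DifferentiableAt ℂ f (σ z) →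
      DifferentiableAt ℂ (fun z => τ (f (σ z))) z)
    (hA : ∀ z, σ z ∈ A ↔ z ∈ A) :
    NormalizedConformal (fun z => τ (f (σ z))) A {w | μ < lemMod (fun j => τ (a j)) m w} := by
  have hσinj : Function.Injective σ := Function.LeftInverse.injective hτσ
  have hτinj : Function.Injective τ := Function.LeftInverse.injective hστ
  have hτiso : ∀ x y, ‖τ x - τ y‖ = ‖x - y‖ := fun x y => by rw [← hiso, hστ, hστ]
  have hσt : Tendsto σ (cobounded ℂ) (cobounded ℂ) := by
    rw [← tendsto_norm_atTop_iff_cobounded]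
    have h1 : Tendsto (fun z : ℂ => ‖z‖ - ‖σ 0‖) (cobounded ℂ) atTop :=
      tendsto_atTop_add_const_right _ _ tendsto_norm_cobounded_atTop
    refine tendsto_atTop_mono (fun z => ?_) h1
    have := hiso z 0
    rw [sub_zero] at this
    rw [← this]
    linarith [norm_sub_le (σ z) (σ 0)]
  refine ⟨hf.isOpen, hf.mem_cobounded, ⟨fun z hz => ?_, fun z hz z' hz' e => ?_, fun w hw => ?_⟩,
    fun z hz => ?_, ?_⟩
  · rw [mem_ofPred_eq, lemMod_comp_isometry hστ hiso, hστ]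
    exact hf.bijOn.mapsTo ((hA z).2 hz)
  · exact hσinj (hf.bijOn.injOn ((hA z).2 hz) ((hA z').2 hz') (hτinj e))
  · rw [mem_ofPred_eq, lemMod_comp_isometry hστ hiso] at hw
    obtain ⟨z, hz, hzw⟩ := hf.bijOn.surjOn hw
    refine ⟨τ z, (hA _).1 (by rwa [hστ]), ?_⟩
    simp only
    rw [hστ, hzw, hτσ]
  · exact (hd f z (hf.differentiableOn.differentiableAt
      (hf.isOpen.mem_nhds ((hA z).2 hz)))).differentiableWithinAt
  · rw [tendsto_zero_iff_norm_tendsto_zero]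
    refine ((tendsto_zero_iff_norm_tendsto_zero.1 hf.tendsto_sub).comp hσt).congr fun z => ?_
    simp only [Function.comp]
    rw [← hτiso, hτσ]

/-- A symmetry of the exterior domain is inherited by its lemniscatic map. -/
theorem IsLemniscaticMap.symmetry (hΦ : IsLemniscaticMap E L Φ) (hE : ∀ j, IsCompact (E j))
    (hne : ∀ j, (E j).Nonempty) (hdisj : ∀ i j, i ≠ j → Disjoint (E i) (E j))
    {Ψ : Sphere → Sphere} (hΨ : InvOn Ψ Φ (exteriorDomain E) L) {σ τ : ℂ → ℂ}
    (hτσ : ∀ z, τ (σ z) = z) (hστ : ∀ z, σ (τ z) = z) (hiso : ∀ x y, ‖σ x - σ y‖ = ‖x - y‖)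
    (hd : ∀ (f : ℂ → ℂ) (z : ℂ), DifferentiableAt ℂ f (σ z) →
      DifferentiableAt ℂ (fun z => τ (f (σ z))) z)
    (hK : exteriorDomain E = OnePoint.map σ '' exteriorDomain E) :
    (∀ z ∈ exteriorDomain E, Φ z = OnePoint.map τ (Φ (OnePoint.map σ z))) ∧
      L = OnePoint.map σ '' L ∧
      ∀ w ∈ L, Ψ w = OnePoint.map τ (Ψ (OnePoint.map σ w)) := by
  obtain ⟨a, m, μ, -, hm, hsum, hμ, rfl⟩ := hΦ.isLemniscaticDomain
  set K := exteriorDomain E with hKdef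
  have hτσ' : ∀ p : Sphere, OnePoint.map τ (OnePoint.map σ p) = p := fun p => by
    induction p using OnePoint.rec with
    | infty => rfl
    | coe z => rw [OnePoint.map_some, OnePoint.map_some, hτσ]
  have hστ' : ∀ p : Sphere, OnePoint.map σ (OnePoint.map τ p) = p := fun p => by
    induction p using OnePoint.rec with
    | infty => rfl
    | coe z => rw [OnePoint.map_some, OnePoint.map_some, hστ]
  have hσinj : Function.Injective (OnePoint.map σ : Sphere → Sphere) :=
    Function.LeftInverse.injective hτσ'
  have hmemK : ∀ p, OnePoint.map σ p ∈ K ↔ p ∈ K := fun p => by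
    conv_lhs => rw [hK]
    exact hσinj.mem_set_image
  have hA : ∀ z, σ z ∈ (⋃ j, E j)ᶜ ↔ z ∈ (⋃ j, E j)ᶜ := fun z => by
    rw [← coe_mem_exteriorDomain, ← coe_mem_exteriorDomain, ← hmemK z, OnePoint.map_some]
  have hf := hΦ.normalizedConformal hE
  have heq := eqOn_of_normalizedConformal hm hsum hm hsum hμ hE hne hdisj hf
    (hf.conj_isometry hτσ hστ hiso hd hA)
  have hΦeq : ∀ z ∈ K, Φ z = OnePoint.map τ (Φ (OnePoint.map σ z)) := fun p hp => by
    induction p using OnePoint.rec with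
    | infty => rw [OnePoint.map_infty, hΦ.normalized.1, OnePoint.map_infty]
    | coe z =>
      have hz := coe_mem_exteriorDomain.1 hp
      have h : toComplex (Φ z) = τ (toComplex (Φ (σ z : ℂ))) := heq hz
      rw [OnePoint.map_some, ← hΦ.coe_toComplex_apply hz,
        ← hΦ.coe_toComplex_apply ((hA z).2 hz), OnePoint.map_some, h]
  -- That `Φ` commutes with the symmetry yields both the invariance of `L` and the statement on the
  -- inverse.
  have hcomm : ∀ z ∈ K, OnePoint.map σ (Φ z) = Φ (OnePoint.map σ z) := fun z hz => by
    rw [hΦeq z hz, hστ']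
  have hbij := hΦ.conformal.1
  have hL : lemniscaticSet a m μ = OnePoint.map σ '' lemniscaticSet a m μ := by
    rw [← hbij.image_eq, image_image]
    conv_lhs => rw [← hKdef, hK, image_image]
    exact image_congr fun z hz => (hcomm z hz).symm
  refine ⟨hΦeq, hL, fun w hw => ?_⟩
  obtain ⟨z, hz, rfl⟩ := hbij.surjOn hw
  rw [hΨ.1 hz, hcomm z hz, hΨ.1 ((hmemK z).2 hz), hτσ']

end

end Walsh

end

theorem lemma2p2 (n : ℕ) (E : Fin n → Set ℂ)
    (hE : ∀ j, Walsh.IsSimplyConnectedCompact (E j))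
    (hE_nontrivial : ∀ j, (E j).Nontrivial)
    (hE_disjoint : ∀ i j, i ≠ j → Disjoint (E i) (E j))
    (K L : Set Walsh.Sphere) (hK : K = Walsh.exteriorDomain E)
    (Φ : Walsh.Sphere → Walsh.Sphere) (hΦ : Walsh.IsLemniscaticMap E L Φ)
    -- `Ψ` is the inverse of `Φ : K → L`
    (Ψ : Walsh.Sphere → Walsh.Sphere) (hΨ : Set.InvOn Ψ Φ K L) :
    (∀ θ : ℝ, K = Walsh.rot θ '' K →
      (∀ z ∈ K, Φ z = Walsh.rot (-θ) (Φ (Walsh.rot θ z))) ∧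
      L = Walsh.rot θ '' L ∧
      (∀ w ∈ L, Ψ w = Walsh.rot (-θ) (Ψ (Walsh.rot θ w)))) ∧
    (K = Walsh.conj '' K →
      (∀ z ∈ K, Φ z = Walsh.conj (Φ (Walsh.conj z))) ∧
      L = Walsh.conj '' L ∧
      (∀ w ∈ L, Ψ w = Walsh.conj (Ψ (Walsh.conj w)))) ∧
    (K = Walsh.neg '' (Walsh.conj '' K) →
      (∀ z ∈ K, Φ z = Walsh.neg (Walsh.conj (Φ (Walsh.neg (Walsh.conj z))))) ∧
      L = Walsh.neg '' (Walsh.conj '' L) ∧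
      (∀ w ∈ L, Ψ w = Walsh.neg (Walsh.conj (Ψ (Walsh.neg (Walsh.conj w)))))) := by
  subst hK
  have hEc : ∀ j, IsCompact (E j) := fun j => (hE j).1
  have hne : ∀ j, (E j).Nonempty := fun j => (hE_nontrivial j).nonempty
  have hconj : ∀ (f : ℂ → ℂ) (z : ℂ), DifferentiableAt ℂ f (starRingEnd ℂ z) →
      DifferentiableAt ℂ (fun z => starRingEnd ℂ (f (starRingEnd ℂ z))) z := fun f z hf => by
    have h := hf.conj_conj
    rwa [Complex.conj_conj] at h
  refine ⟨fun θ h => ?_, fun h => ?_, fun h => ?_⟩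
  · have hinv : ∀ θ : ℝ, Complex.exp ((-θ : ℝ) * Complex.I) * Complex.exp (θ * Complex.I) = 1 :=
      fun θ => by
        rw [← Complex.exp_add, ← add_mul]
        simp
    have hinv' : ∀ θ : ℝ, Complex.exp (θ * Complex.I) * Complex.exp ((-θ : ℝ) * Complex.I) = 1 :=
      fun θ => by rw [mul_comm, hinv]
    refine hΦ.symmetry hEc hne hE_disjoint hΨ
      (σ := fun z => Complex.exp (θ * Complex.I) * z)
      (τ := fun z => Complex.exp ((-θ : ℝ) * Complex.I) * z) (fun z => ?_) (fun z => ?_)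
      (fun x y => ?_) (fun f z hf => ?_) h
    · rw [← mul_assoc, hinv, one_mul]
    · rw [← mul_assoc, hinv', one_mul]
    · rw [← mul_sub, norm_mul, Complex.norm_exp_ofReal_mul_I, one_mul]
    · exact (hf.comp z (differentiableAt_id.const_mul _)).const_mul _
  · refine hΦ.symmetry hEc hne hE_disjoint hΨ (σ := fun z => starRingEnd ℂ z)
      (τ := fun z => starRingEnd ℂ z) Complex.conj_conj Complex.conj_conj (fun x y => ?_)
      hconj h
    rw [← map_sub, Complex.norm_conj]
  -- Negation after conjugation is a single isometry, its own inverse, to which the general symmetry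
  -- lemma applies.
  · have hnc : ∀ p : Walsh.Sphere,
        Walsh.neg (Walsh.conj p) = OnePoint.map (fun z => -starRingEnd ℂ z) p := fun p => by
      induction p using OnePoint.rec <;> rfl
    simp only [Set.image_image, hnc] at h ⊢
    refine hΦ.symmetry hEc hne hE_disjoint hΨ (σ := fun z => -starRingEnd ℂ z)
      (τ := fun z => -starRingEnd ℂ z) (fun z => ?_) (fun z => ?_) (fun x y => ?_)
      (fun f z hf => ?_) h
    · simp
    · simp
    · rw [← norm_neg, ← Complex.norm_conj]
      simp [sub_eq_add_neg, add_comm]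
    · have h1 := hconj (fun z => f (-z)) z (DifferentiableAt.comp _ hf differentiableAt_id.neg)
      exact h1.neg
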